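/- Let $U:L^2(\mathbb R)\to\mathcal H$ be a unitary map onto a complex Hilbert space $\mathcal H$, and let $Q$ and $P$ be the operators in $\mathcal H$ which $U$ carries over from the position operator (multiplication by $t$ on its maximal domain) and the momentum operator ($-i\,d/dt$ with its natural self-adjoint domain) in $L^2(\mathbb R)$. Powers and products of unbounded operators have their natural domains, and $A^0=I$. Put $W(q,p)=UW_0(q,p)U^{-1}$, where $(W_0(q,p)f)(t)=e^{\frac i2qp}e^{ipt}f(t+q)$. Let $T$ be a positive trace class operator on $\mathcal H$ with $\mathrm{Tr}[T]=1$, and let $E^T$ be the translation covariant observable on the phase space $\mathbb R^2$ generated by $T$, that is, the positive operator measure $$E^T(B)=\frac1{2\pi}\int_B W(-q,p)\,T\,W(-q,p)^*\,dq\,dp\qquad(B\subset\mathbb R^2\text{ Borel}),$$ where the integral is understood weakly. For a measurable function $f:\mathbb R^2\to\mathbb C$ let $L(f,E^T)$ be the operator integral: its domain $D(f,E^T)$ consists of all $\varphi\in\mathcal H$ such that $f$ is integrable with respect to the complex measure $E^T_{\psi,\varphi}:B\mapsto\langle\psi|E^T(B)\varphi\rangle$ for every $\psi\in\mathcal H$,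 and $\langle\psi|L(f,E^T)\varphi\rangle=\int f\,dE^T_{\psi,\varphi}$ for all $\varphi\in D(f,E^T)$ and $\psi\in\mathcal H$. For $k\in\mathbb N=\{0,1,2,\dots\}$ let $x^k$ and $y^k$ denote the functions $(q,p)\mapsto q^k$ and $(q,p)\mapsto p^k$. (a) If $Q^k\sqrt T$ is a Hilbert–Schmidt operator (in particular everywhere defined), then $Q^{k-l}T$ is an (everywhere defined) trace class operator for each $l=0,\dots,k$, and $$L(x^k,E^T)=\sum_{l=0}^k\binom kl(-1)^{k-l}\,\mathrm{Tr}[Q^{k-l}T]\;Q^l$$ as an equality of unbounded operators, including the equality of their domains. (b) If $P^k\sqrt T$ is a Hilbert–Schmidt operator, then $P^{k-l}T$ is a trace class operator for each $l=0,\dots,k$, and $$L(y^k,E^T)=\sum_{l=0}^k\binom kl(-1)^{k-l}\,\mathrm{Tr}[P^{k-l}T]\;P^l$$ as an equality of unbounded operators, including the equality of their domains. -/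

import Mathlib

open MeasureTheory Filter
open scoped ENNReal InnerProductSpace Topology

namespace PhaseSpaceQuantization

noncomputable section

section Abstract

variable {Ω : Type*} [MeasurableSpace Ω]
variable {H : Type*} [NormedAddCommGroup H] [InnerProductSpace ℂ H]

/-! ### Positive operator measures and the operator integral -/

variable (Ω H) in
/-- A positive operator measure on `Ω`: a set function on the measurable sets (extended by `0` to
the other sets, as Mathlib does for vector measures) with values in the positive bounded operators
on `H`, σ-additive in the weak operator topology. -/
structure PositiveOperatorMeasure where
  toFun : Set Ω → (H →L[ℂ] H)
  isPositive : ∀ B, (toFun B).IsPositive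
  not_measurable : ∀ B, ¬ MeasurableSet B → toFun B = 0
  empty : toFun ∅ = 0
  hasSum_inner : ∀ B : ℕ → Set Ω, (∀ i, MeasurableSet (B i)) →
    Pairwise (Function.onFun Disjoint B) →
    ∀ ψ φ : H, HasSum (fun i => ⟪ψ, toFun (B i) φ⟫_ℂ) ⟪ψ, toFun (⋃ i, B i) φ⟫_ℂ

namespace PositiveOperatorMeasure

@[ext]
theorem ext {E F : PositiveOperatorMeasure Ω H} (h : ∀ B, E.toFun B = F.toFun B) : E = F := by
  cases E
  cases F
  congr
  exact funext h

/-- The zero operator measure. -/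
instance : Inhabited (PositiveOperatorMeasure Ω H) where
  default :=
    { toFun := fun _ => 0
      isPositive := fun _ => ContinuousLinearMap.isPositive_zero
      not_measurable := fun _ _ => rfl
      empty := rfl
      hasSum_inner := fun _ _ _ ψ φ => by simp }

/-- The complex measure `E_{ψ,φ} : B ↦ ⟪ψ, E(B) φ⟫`. -/
def scalar (E : PositiveOperatorMeasure Ω H) (ψ φ : H) : ComplexMeasure Ω where
  measureOf' B := ⟪ψ, E.toFun B φ⟫_ℂ
  empty' := by simp [E.empty]
  not_measurable' B hB := by simp [E.not_measurable B hB]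
  m_iUnion' B hB hd := E.hasSum_inner B hB hd ψ φ

/-- The integral `∫ f dE_{ψ,φ}` of a complex function with respect to the complex measure
`E_{ψ,φ}`. -/
def integral (E : PositiveOperatorMeasure Ω H) (f : Ω → ℂ) (ψ φ : H) : ℂ :=
  (E.scalar ψ φ).integral f (ContinuousLinearMap.mul ℝ ℂ)

variable (E : PositiveOperatorMeasure Ω H) (f : Ω → ℂ)

theorem scalar_apply (ψ φ : H) (B : Set Ω) : E.scalar ψ φ B = ⟪ψ, E.toFun B φ⟫_ℂ := rfl

theorem scalar_add_right (ψ φ φ' : H) :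
    E.scalar ψ (φ + φ') = E.scalar ψ φ + E.scalar ψ φ' := by
  ext B hB
  simp [scalar_apply]

theorem scalar_smul_right (c : ℂ) (ψ φ : H) :
    E.scalar ψ (c • φ) = c • E.scalar ψ φ := by
  ext B hB
  simp [scalar_apply]

theorem scalar_zero_right (ψ : H) : E.scalar ψ 0 = 0 := by
  ext B hB
  simp [scalar_apply]

theorem integrable_smul {μ : ComplexMeasure Ω} (c : ℂ) (h : μ.Integrable f) :
    (c • μ).Integrable f := by
  refine Integrable.mono_measure (Integrable.smul_measure_nnreal h (c := ‖c‖₊)) ?_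
  simp [VectorMeasure.variation_smul]

/-- The subspace `D(f,E)` of all `φ` such that `f` is `E_{ψ,φ}`-integrable (that is, integrable
with respect to the total variation of `E_{ψ,φ}`) for every `ψ`. -/
def domain : Submodule ℂ H where
  carrier := {φ | ∀ ψ : H, (E.scalar ψ φ).Integrable f}
  zero_mem' := fun ψ => by
    rw [scalar_zero_right]
    exact VectorMeasure.Integrable.zero_vectorMeasure
  add_mem' := fun {a b} ha hb ψ => by
    rw [scalar_add_right]
    exact VectorMeasure.Integrable.add_vectorMeasure (ha ψ) (hb ψ)
  smul_mem' := fun c a ha ψ => by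
    rw [scalar_smul_right]
    exact integrable_smul f c (ha ψ)

variable {f}

theorem integral_eq_lim {μ : ComplexMeasure Ω} (hf : Measurable f) (h : μ.Integrable f) :
    Tendsto (fun n => ∑ c ∈ (SimpleFunc.approxOn f hf (Set.range f ∪ {0}) 0 (by simp) n).range,
      c * μ ((SimpleFunc.approxOn f hf (Set.range f ∪ {0}) 0 (by simp) n) ⁻¹' {c})) atTop
      (𝓝 (μ.integral f (ContinuousLinearMap.mul ℝ ℂ))) := by
  have hint : ∀ n, Integrable
      (SimpleFunc.approxOn f hf (Set.range f ∪ {0}) 0 (by simp) n) μ.variation :=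
    fun n => SimpleFunc.integrable_approxOn_range hf h n
  have hlim := VectorMeasure.tendsto_integral_of_L1 (μ := μ) (B := ContinuousLinearMap.mul ℝ ℂ)
    f h.1 (Eventually.of_forall hint) (l := atTop)
    (SimpleFunc.tendsto_approxOn_range_L1_enorm hf h)
  refine hlim.congr fun n => ?_
  rw [VectorMeasure.integral_eq_setToFun, setToFun_simpleFunc _ _ (hint n)]
  rfl

/-- For `φ ∈ D(f,E)` the functional `ψ ↦ ∫ f dE_{ψ,φ}` is represented by a vector. -/
theorem exists_inner_eq_integral [CompleteSpace H] (hf : Measurable f) {φ : H}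
    (hφ : φ ∈ E.domain f) : ∃ η : H, ∀ ψ : H, ⟪ψ, η⟫_ℂ = E.integral f ψ φ := by
  let g := fun n => SimpleFunc.approxOn f hf (Set.range f ∪ {0}) 0 (by simp) n
  let η : ℕ → H := fun n => ∑ c ∈ (g n).range, c • E.toFun (g n ⁻¹' {c}) φ
  have hη : ∀ ψ, Tendsto (fun n => ⟪ψ, η n⟫_ℂ) atTop (𝓝 (E.integral f ψ φ)) := by
    intro ψ
    refine (integral_eq_lim hf (hφ ψ)).congr fun n => ?_
    simp [η, g, scalar_apply]
  have hη' : Tendsto (fun n ψ => innerSL ℂ (η n) ψ) atTop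
      (𝓝 (fun ψ => (starRingEnd ℂ) (E.integral f ψ φ))) := by
    refine tendsto_pi_nhds.2 fun ψ => ?_
    refine ((Complex.continuous_conj.tendsto _).comp (hη ψ)).congr fun n => ?_
    simp
  let ℓ : H →L[ℂ] ℂ := continuousLinearMapOfTendsto (fun n => innerSL ℂ (η n)) hη'
  refine ⟨(InnerProductSpace.toDual ℂ H).symm ℓ, fun ψ => ?_⟩
  rw [← inner_conj_symm, InnerProductSpace.toDual_symm_apply]
  change (starRingEnd ℂ) ((starRingEnd ℂ) (E.integral f ψ φ)) = _
  simp

theorem integral_add_right {φ φ' : H} (ψ : H) (h : φ ∈ E.domain f) (h' : φ' ∈ E.domain f) :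
    E.integral f ψ (φ + φ') = E.integral f ψ φ + E.integral f ψ φ' := by
  rw [integral, scalar_add_right, VectorMeasure.integral_add_vectorMeasure (h ψ) (h' ψ)]
  rfl

theorem integral_smul_right (hf : Measurable f) {φ : H} (ψ : H) (c : ℂ) (h : φ ∈ E.domain f) :
    E.integral f ψ (c • φ) = c * E.integral f ψ φ := by
  refine tendsto_nhds_unique (integral_eq_lim hf ((E.domain f).smul_mem c h ψ)) ?_
  refine ((integral_eq_lim hf (h ψ)).const_mul c).congr fun n => ?_
  simp only [scalar_smul_right, Finset.mul_sum]
  refine Finset.sum_congr rfl fun d _ => ?_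
  simp only [FunLike.coe_smul, Pi.smul_apply, smul_eq_mul]
  ring

/-- The operator integral `L(f,E) = ∫ f dE` of a measurable function `f`: the linear operator with
domain `D(f,E)` determined by `⟪ψ, L(f,E) φ⟫ = ∫ f dE_{ψ,φ}` for all `ψ`. -/
def operatorIntegral [CompleteSpace H] (hf : Measurable f) : H →ₗ.[ℂ] H where
  domain := E.domain f
  toFun :=
    { toFun := fun φ => (E.exists_inner_eq_integral hf φ.2).choose
      map_add' := fun a b => by
        refine ext_inner_left ℂ fun ψ => ?_
        rw [inner_add_right, (E.exists_inner_eq_integral hf (a + b).2).choose_spec ψ,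
          (E.exists_inner_eq_integral hf a.2).choose_spec ψ,
          (E.exists_inner_eq_integral hf b.2).choose_spec ψ]
        exact E.integral_add_right ψ a.2 b.2
      map_smul' := fun c a => by
        refine ext_inner_left ℂ fun ψ => ?_
        rw [inner_smul_right, (E.exists_inner_eq_integral hf (c • a).2).choose_spec ψ,
          RingHom.id_apply, (E.exists_inner_eq_integral hf a.2).choose_spec ψ]
        exact E.integral_smul_right hf ψ c a.2 }

theorem inner_operatorIntegral [CompleteSpace H] (hf : Measurable f) (ψ : H)
    (φ : (E.operatorIntegral hf).domain) :
    ⟪ψ, E.operatorIntegral hf φ⟫_ℂ = E.integral f ψ φ :=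
  (E.exists_inner_eq_integral hf φ.2).choose_spec ψ

end PositiveOperatorMeasure

/-! ### Unbounded operators: products, powers, unitary transport -/

/-- A bounded operator as an everywhere defined operator. -/
def ofBounded (S : H →L[ℂ] H) : H →ₗ.[ℂ] H := (S : H →ₗ[ℂ] H).toPMap ⊤

/-- The product `A B` of two operators, on its natural domain `{φ ∈ D(B) | B φ ∈ D(A)}`. -/
def prodOp (A B : H →ₗ.[ℂ] H) : H →ₗ.[ℂ] H where
  domain :=
    { carrier := {φ | ∃ h : φ ∈ B.domain, B ⟨φ, h⟩ ∈ A.domain}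
      zero_mem' := ⟨B.domain.zero_mem, by
        have : B ⟨0, B.domain.zero_mem⟩ = 0 := B.map_zero
        rw [this]
        exact A.domain.zero_mem⟩
      add_mem' := by
        rintro a b ⟨ha, ha'⟩ ⟨hb, hb'⟩
        refine ⟨B.domain.add_mem ha hb, ?_⟩
        have : B ⟨a + b, B.domain.add_mem ha hb⟩ = B ⟨a, ha⟩ + B ⟨b, hb⟩ :=
          B.map_add ⟨a, ha⟩ ⟨b, hb⟩
        rw [this]
        exact A.domain.add_mem ha' hb'
      smul_mem' := by
        rintro c a ⟨ha, ha'⟩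
        refine ⟨B.domain.smul_mem c ha, ?_⟩
        have : B ⟨c • a, B.domain.smul_mem c ha⟩ = c • B ⟨a, ha⟩ := B.map_smul c ⟨a, ha⟩
        rw [this]
        exact A.domain.smul_mem c ha' }
  toFun :=
    { toFun := fun φ => A ⟨B ⟨φ, φ.2.fst⟩, φ.2.snd⟩
      map_add' := fun a b => by
        rw [← A.map_add]
        congr 1
        exact Subtype.ext (B.map_add ⟨a, a.2.fst⟩ ⟨b, b.2.fst⟩)
      map_smul' := fun c a => by
        rw [RingHom.id_apply, ← A.map_smul]
        congr 1
        exact Subtype.ext (B.map_smul c ⟨a, a.2.fst⟩) }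

/-- The powers `A ^ k` of an operator on their natural domains, with `A ^ 0 = I`. -/
def powOp (A : H →ₗ.[ℂ] H) : ℕ → (H →ₗ.[ℂ] H)
  | 0 => ofBounded (ContinuousLinearMap.id ℂ H)
  | k + 1 => prodOp A (powOp A k)

/-- The operator `U A U⁻¹`, with domain `U D(A)`, for a unitary map `U : K → H`. -/
def transport {K : Type*} [NormedAddCommGroup K] [InnerProductSpace ℂ K]
    (U : K ≃ₗᵢ[ℂ] H) (A : K →ₗ.[ℂ] K) : H →ₗ.[ℂ] H where
  domain := A.domain.comap (U.symm.toLinearEquiv : H →ₗ[ℂ] K)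
  toFun :=
    { toFun := fun φ => U (A ⟨U.symm φ, φ.2⟩)
      map_add' := fun a b => by
        rw [← map_add, ← A.map_add]
        congr 2
        exact Subtype.ext (map_add U.symm (a : H) b)
      map_smul' := fun c a => by
        rw [RingHom.id_apply, ← map_smul, ← A.map_smul]
        congr 2
        exact Subtype.ext (map_smul U.symm c (a : H)) }

/-! ### Hilbert-Schmidt operators, trace class operators, trace -/

variable [CompleteSpace H]

variable (H) in
/-- The index set of an orthonormal basis of `H`, fixed once and for all. -/
def basisIndex : Set H := (exists_hilbertBasis ℂ H).choose

variable (H) in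
/-- An orthonormal basis of `H`, fixed once and for all. The three notions below do not depend on
its choice. -/
def onb : HilbertBasis (basisIndex H) ℂ H := (exists_hilbertBasis ℂ H).choose_spec.choose

/-- `A` is a Hilbert-Schmidt operator: it is everywhere defined and bounded, and
`∑ ‖A eᵢ‖²` is finite for an orthonormal basis `(eᵢ)`. -/
def IsHilbertSchmidt (A : H →ₗ.[ℂ] H) : Prop :=
  ∃ S : H →L[ℂ] H, A = ofBounded S ∧ Summable (fun i => ‖S (onb H i)‖ ^ 2)

/-- `A` is a trace class operator: it is everywhere defined and bounded, and
`∑ ⟪eᵢ, |A| eᵢ⟫` is finite for an orthonormal basis `(eᵢ)`, where `|A| = √(A* A)`. -/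
def IsTraceClass (A : H →ₗ.[ℂ] H) : Prop :=
  ∃ S : H →L[ℂ] H, A = ofBounded S ∧
    Summable (fun i => (⟪onb H i, CFC.abs S (onb H i)⟫_ℂ).re)

open scoped Classical in
/-- The trace `∑ ⟪eᵢ, A eᵢ⟫` of an operator `A`, meaningful when `A` is a trace class operator (so
that the basis vectors `eᵢ` are in its domain and the series converges absolutely). -/
def trace (A : H →ₗ.[ℂ] H) : ℂ :=
  ∑' i, if h : (onb H i : H) ∈ A.domain then ⟪(onb H i : H), A ⟨onb H i, h⟩⟫_ℂ else 0

end Abstract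

/-! ### Position, momentum and the Weyl operators -/

/-- The Hilbert space `L²(ℝ)` with Lebesgue measure. -/
abbrev L2R : Type := Lp ℂ 2 (volume : Measure ℝ)

/-- The position operator in `L²(ℝ)`: multiplication by `t`, on the maximal domain. -/
def position : L2R →ₗ.[ℂ] L2R where
  domain :=
    { carrier := {f | MemLp (fun t : ℝ => (t : ℂ) * f t) 2 volume}
      zero_mem' := by
        refine (MemLp.zero' : MemLp (fun _ : ℝ => (0 : ℂ)) 2 volume).ae_eq ?_
        filter_upwards [Lp.coeFn_zero ℂ 2 (volume : Measure ℝ)] with t ht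
        simp [ht]
      add_mem' := by
        intro f g hf hg
        refine (MemLp.add hf hg).ae_eq ?_
        filter_upwards [Lp.coeFn_add f g] with t ht
        rw [ht]
        simp only [Pi.add_apply, mul_add]
      smul_mem' := by
        intro c f hf
        refine (MemLp.const_smul hf c).ae_eq ?_
        filter_upwards [Lp.coeFn_smul c f] with t ht
        simp only [Pi.smul_apply, ht, smul_eq_mul]
        ring }
  toFun :=
    { toFun := fun f => MemLp.toLp (fun t : ℝ => (t : ℂ) * (f : L2R) t) f.2
      map_add' := fun f g => by
        rw [← MemLp.toLp_add]
        refine MemLp.toLp_congr _ _ ?_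
        filter_upwards [Lp.coeFn_add (f : L2R) (g : L2R)] with t ht
        rw [Submodule.coe_add, ht]
        simp only [Pi.add_apply, mul_add]
      map_smul' := fun c f => by
        rw [RingHom.id_apply, ← MemLp.toLp_const_smul]
        refine MemLp.toLp_congr _ _ ?_
        filter_upwards [Lp.coeFn_smul c (f : L2R)] with t ht
        simp only [Submodule.coe_smul, Pi.smul_apply, ht, smul_eq_mul]
        ring }

/-- The momentum operator `-i d/dt` in `L²(ℝ)`, namely `F⁻¹ M F`, where `F` is Mathlib's `L²` Fourier
transform `(F f)(ξ) = ∫ f(t) exp(-2πi t ξ) dt` and `M` is multiplication by `2πξ` on its maximal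
domain. -/
def momentum : L2R →ₗ.[ℂ] L2R :=
  transport (Lp.fourierTransformₗᵢ ℝ ℂ).symm ((2 * (Real.pi : ℂ)) • position)

theorem memLp_weyl (q p : ℝ) (f : L2R) :
    MemLp (fun t : ℝ => Complex.exp (Complex.I * (q * p / 2)) * Complex.exp (Complex.I * (p * t)) *
      f (t + q)) 2 volume := by
  have h1 : MemLp (fun t : ℝ => f (t + q)) 2 volume :=
    (Lp.memLp f).comp_measurePreserving (measurePreserving_add_right volume q)
  refine h1.of_le ?_ (Eventually.of_forall fun t => ?_)
  · refine AEStronglyMeasurable.mul (Continuous.aestronglyMeasurable (by fun_prop)) h1.1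
  · rw [norm_mul, norm_mul]
    have e1 : ‖Complex.exp (Complex.I * (q * p / 2))‖ = 1 := by
      have := Complex.norm_exp_I_mul_ofReal (q * p / 2)
      push_cast at this
      exact this
    have e2 : ‖Complex.exp (Complex.I * (p * t))‖ = 1 := by
      have := Complex.norm_exp_I_mul_ofReal (p * t)
      push_cast at this
      exact this
    simp [e1, e2]

/-- The Weyl operators `(W₀(q,p) f)(t) = exp(i q p / 2) exp(i p t) f(t + q)` on `L²(ℝ)`. -/
def weyl₀ (q p : ℝ) : L2R →ₗᵢ[ℂ] L2R where
  toFun f := MemLp.toLp _ (memLp_weyl q p f)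
  map_add' f g := by
    rw [← MemLp.toLp_add]
    refine MemLp.toLp_congr _ _ ?_
    have h := (measurePreserving_add_right (volume : Measure ℝ) q).quasiMeasurePreserving.ae
      (Lp.coeFn_add f g)
    filter_upwards [h] with t ht
    rw [ht]
    simp only [Pi.add_apply, mul_add]
  map_smul' c f := by
    rw [RingHom.id_apply, ← MemLp.toLp_const_smul]
    refine MemLp.toLp_congr _ _ ?_
    have h := (measurePreserving_add_right (volume : Measure ℝ) q).quasiMeasurePreserving.ae
      (Lp.coeFn_smul c f)
    filter_upwards [h] with t ht
    simp only [Pi.smul_apply, ht, smul_eq_mul]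
    ring
  norm_map' f := by
    change ‖MemLp.toLp _ (memLp_weyl q p f)‖ = ‖f‖
    rw [Lp.norm_toLp, Lp.norm_def]
    congr 1
    rw [← eLpNorm_comp_measurePreserving (Lp.aestronglyMeasurable f)
      (measurePreserving_add_right (volume : Measure ℝ) q)]
    refine eLpNorm_congr_norm_ae (Eventually.of_forall fun t => ?_)
    have e1 : ‖Complex.exp (Complex.I * (q * p / 2))‖ = 1 := by
      have := Complex.norm_exp_I_mul_ofReal (q * p / 2)
      push_cast at this
      exact this
    have e2 : ‖Complex.exp (Complex.I * (p * t))‖ = 1 := by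
      have := Complex.norm_exp_I_mul_ofReal (p * t)
      push_cast at this
      exact this
    simp [e1, e2]

section PhaseSpace

variable {H : Type*} [NormedAddCommGroup H] [InnerProductSpace ℂ H] [CompleteSpace H]

/-- The position operator `Q` in `H`, carried over by the unitary map `U : L²(ℝ) → H`. -/
def opQ (U : L2R ≃ₗᵢ[ℂ] H) : H →ₗ.[ℂ] H := transport U position

/-- The momentum operator `P` in `H`, carried over by the unitary map `U : L²(ℝ) → H`. -/
def opP (U : L2R ≃ₗᵢ[ℂ] H) : H →ₗ.[ℂ] H := transport U momentum

/-- The Weyl operators `W(q,p) = U W₀(q,p) U⁻¹` on `H`. -/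
def weyl (U : L2R ≃ₗᵢ[ℂ] H) (q p : ℝ) : H →L[ℂ] H :=
  (U : L2R →L[ℂ] H) ∘L (weyl₀ q p).toContinuousLinearMap ∘L (U.symm : H →L[ℂ] L2R)

/-- The phase space translations `β(q,p)(T) = W(-q,p) T W(-q,p)*`. -/
def beta (U : L2R ≃ₗᵢ[ℂ] H) (z : ℝ × ℝ) (T : H →L[ℂ] H) : H →L[ℂ] H :=
  weyl U (-z.1) z.2 ∘L T ∘L ContinuousLinearMap.adjoint (weyl U (-z.1) z.2)

/-- `E(B) = (2π)⁻¹ ∫_B β(q,p)(T) dq dp` for every Borel set `B`, as a weak integral. -/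
def IsGeneratedBy (U : L2R ≃ₗᵢ[ℂ] H) (T : H →L[ℂ] H)
    (E : PositiveOperatorMeasure (ℝ × ℝ) H) : Prop :=
  ∀ B : Set (ℝ × ℝ), MeasurableSet B → ∀ ψ φ : H,
    IntegrableOn (fun z => ⟪ψ, beta U z T φ⟫_ℂ) B ∧
    ⟪ψ, E.toFun B φ⟫_ℂ = (2 * (Real.pi : ℂ))⁻¹ * ∫ z in B, ⟪ψ, beta U z T φ⟫_ℂ

theorem IsGeneratedBy.unique {U : L2R ≃ₗᵢ[ℂ] H} {T : H →L[ℂ] H}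
    {E F : PositiveOperatorMeasure (ℝ × ℝ) H} (hE : IsGeneratedBy U T E)
    (hF : IsGeneratedBy U T F) : E = F := by
  ext B φ
  by_cases hB : MeasurableSet B
  · refine ext_inner_left ℂ fun ψ => ?_
    rw [(hE B hB ψ φ).2, (hF B hB ψ φ).2]
  · rw [E.not_measurable B hB, F.not_measurable B hB]

open scoped Classical in
/-- The translation covariant observable `E^T` generated by `T`, that is, the unique positive
operator measure `E` on the phase space `ℝ²` with `E(B) = (2π)⁻¹ ∫_B β(q,p)(T) dq dp`. (If there
were none, as when `T` is not of trace class, the value would be the zero measure.) -/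
def covariantObservable (U : L2R ≃ₗᵢ[ℂ] H) (T : H →L[ℂ] H) :
    PositiveOperatorMeasure (ℝ × ℝ) H :=
  if h : ∃ E, IsGeneratedBy U T E then h.choose else default

/-- The function `x^k : (q,p) ↦ q^k` on the phase space. -/
def xPow (k : ℕ) (z : ℝ × ℝ) : ℂ := (z.1 : ℂ) ^ k

/-- The function `y^k : (q,p) ↦ p^k` on the phase space. -/
def yPow (k : ℕ) (z : ℝ × ℝ) : ℂ := (z.2 : ℂ) ^ k

theorem measurable_xPow (k : ℕ) : Measurable (xPow k) := by
  unfold xPow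
  fun_prop

theorem measurable_yPow (k : ℕ) : Measurable (yPow k) := by
  unfold yPow
  fun_prop

/-- The polynomial `∑_{l=0}^k C(k,l) (-1)^{k-l} Tr[A^{k-l} T] A^l` in the operator `A`, on its
natural domain, the intersection of the domains of the `A^l`. -/
def momentPolynomial (A : H →ₗ.[ℂ] H) (T : H →L[ℂ] H) (k : ℕ) : H →ₗ.[ℂ] H :=
  ∑ l ∈ Finset.range (k + 1),
    ((k.choose l : ℂ) * (-1) ^ (k - l) * trace (prodOp (powOp A (k - l)) (ofBounded T))) • powOp A l

end PhaseSpace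

end

end PhaseSpaceQuantization

open PhaseSpaceQuantization

open scoped FourierTransform
open scoped InnerProduct

/-! Write `T = S²` with `S = √T`, which is Hilbert–Schmidt because `T` is trace class. The measure
`E_{ψ,φ}` has density `(2π)⁻¹ ⟪S W* ψ, S W* φ⟫` on phase space. On the diagonal, Parseval turns this
density into a sum of squared Weyl matrix elements `|⟪W S eₙ, φ⟫|²`. For fixed `q` such a matrix
element is, up to a phase, a Fourier transform in `p`, so Plancherel integrates `p` out. The
`q`-marginal of `E_{φ,φ}` is therefore the law of `t - s` under the product of `|φ(t)|² dt` and `∑ₙ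
|(S eₙ)(s)|² ds` (`lintegral_mul_enorm_sq_translated`, `map_withDensity_translated`). The moments of
the second measure are the traces `Tr[Qʲ T]` (`integral_pow_rangeMeasure`), and the binomial theorem
gives the diagonal matrix elements of the claimed polynomial (`integral_prod_sub_pow`).

Let `L` be the operator integral and `M` the polynomial. If `φ ∈ D(Qᵏ) = D(M)`, then `qᵏ ‖S W* φ‖`
is square integrable, and Cauchy–Schwarz against `‖S W* ψ‖` puts `φ` in `D(L)`. The converse
inclusion needs no lower bound on the variation of `E_{ψ,φ}`: `L` is symmetric, and `M` is
multiplication by a real polynomial, monic because `Tr T = 1`, on its maximal domain. Such an `M`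
has no proper symmetric extension, and `L` agrees with it on `D(M)` by polarization
(`eq_of_symmetric_of_diagonal`).

The momentum case is the same argument. The Fourier transform carries Weyl operators to Weyl
operators with phase space rotated to `(p,-q)` and rescaled by `2π` (`fourierTransform_weyl₀`), so
everything is proved for a multiplication operator by `c t` and an area-preserving change of
variables `R`. -/

/-! ### The Fourier transform on `L¹ ∩ L²`. -/

theorem integral_schwartz_smul_fourier {g : ℝ → ℂ} (h1 : Integrable g) (ϕ : SchwartzMap ℝ ℂ) :
    ∫ x, 𝓕 (ϕ : ℝ → ℂ) x • g x = ∫ x, ϕ x • 𝓕 g x := by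
  have := VectorFourier.integral_fourierIntegral_smul_eq_flip (μ := volume) (ν := volume)
    (L := innerₗ ℝ) (f := (ϕ : ℝ → ℂ)) (g := g) Real.continuous_fourierChar continuous_inner
    ϕ.integrable h1
  rw [flip_innerₗ] at this
  exact this

/-- On `L¹ ∩ L²` the `L²` Fourier transform is given by the Fourier integral. -/
theorem coeFn_fourierTransform_toLp {g : ℝ → ℂ} (h1 : Integrable g) (h2 : MemLp g 2 volume) :
    (Lp.fourierTransformₗᵢ ℝ ℂ (h2.toLp g) : ℝ → ℂ) =ᵐ[volume] 𝓕 g := by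
  refine ae_eq_of_integral_contDiff_smul_eq
    ((Lp.memLp _).locallyIntegrable (by norm_num))
    (VectorFourier.fourierIntegral_continuous Real.continuous_fourierChar
      continuous_inner h1).locallyIntegrable ?_
  intro u hu hc
  have hg₁ : HasCompactSupport (Complex.ofRealCLM ∘ u) := hc.comp_left rfl
  have hg₂ : ContDiff ℝ ((⊤ : ℕ∞) : WithTop ℕ∞) (Complex.ofRealCLM ∘ u) := by fun_prop
  -- The `L²` transform is also the distributional one, so both sides can be paired with a test
  -- function and the transform moved onto it.
  have key := congrArg (fun D => D (hg₁.toSchwartzMap hg₂))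
    (Lp.fourier_toTemperedDistribution_eq (h2.toLp g))
  simp only [TemperedDistribution.fourier_apply, Lp.toTemperedDistribution_apply] at key
  have e2 : ∫ x, u x • (Lp.fourierTransformₗᵢ ℝ ℂ (h2.toLp g)) x =
      ∫ x, (hg₁.toSchwartzMap hg₂) x • (𝓕 (h2.toLp g) : L2R) x :=
    integral_congr_ae (Eventually.of_forall fun x => by
      change _ = (hg₁.toSchwartzMap hg₂) x • (Lp.fourierTransformₗᵢ ℝ ℂ (h2.toLp g)) x
      simp)
  have e3 : ∫ x, (𝓕 (hg₁.toSchwartzMap hg₂)) x • (h2.toLp g) x =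
      ∫ x, 𝓕 ((hg₁.toSchwartzMap hg₂ : SchwartzMap ℝ ℂ) : ℝ → ℂ) x • g x := by
    refine integral_congr_ae ?_
    filter_upwards [h2.coeFn_toLp] with x hx
    rw [hx, SchwartzMap.fourier_coe]
  rw [e2, ← key, e3, integral_schwartz_smul_fourier h1]
  exact integral_congr_ae (Eventually.of_forall fun x => by simp)

/-- Plancherel's theorem on `L¹ ∩ L²`. -/
theorem lintegral_enorm_sq_fourier {g : ℝ → ℂ} (h1 : Integrable g) (h2 : MemLp g 2 volume) :
    ∫⁻ x, ‖𝓕 g x‖ₑ ^ 2 = ∫⁻ x, ‖g x‖ₑ ^ 2 := by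
  have h : ∀ f : ℝ → ℂ, ∫⁻ x, ‖f x‖ₑ ^ 2 = eLpNorm f 2 volume ^ 2 := fun f => by
    have := eLpNorm_nnreal_pow_eq_lintegral (f := f) (μ := (volume : Measure ℝ)) (p := 2)
      two_ne_zero
    simpa using this.symm
  rw [h, h, ← eLpNorm_congr_ae (coeFn_fourierTransform_toLp h1 h2),
    ← eLpNorm_congr_ae h2.coeFn_toLp]
  have := (Lp.fourierTransformₗᵢ ℝ ℂ).norm_map (h2.toLp g)
  rw [← Lp.enorm_def, ← Lp.enorm_def, ← ofReal_norm, this, ofReal_norm]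

theorem lintegral_comp_mul_left (c : ℝ) (hc : 0 < c) (f : ℝ → ℝ≥0∞) :
    ∫⁻ x, f (c * x) = ENNReal.ofReal c⁻¹ * ∫⁻ x, f x := by
  have h := lintegral_map_equiv (μ := volume) f (MeasurableEquiv.mulLeft₀ c hc.ne')
  have h' : Measure.map (MeasurableEquiv.mulLeft₀ c hc.ne') (volume : Measure ℝ) =
      ENNReal.ofReal |c⁻¹| • volume := Real.map_volume_mul_left hc.ne'
  rw [h', lintegral_smul_measure, abs_of_pos (inv_pos.2 hc)] at h
  exact h.symm

/-! ### Weyl operators on `L²(ℝ)`. -/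

theorem coeFn_weyl₀ (q p : ℝ) (f : L2R) :
    (weyl₀ q p f : ℝ → ℂ) =ᵐ[volume] fun t : ℝ => Complex.exp (Complex.I * (q * p / 2)) *
      Complex.exp (Complex.I * (p * t)) * f (t + q) :=
  MemLp.coeFn_toLp (memLp_weyl q p f)

theorem norm_exp_I_mul (x y : ℝ) : ‖Complex.exp (Complex.I * (x * y))‖ = 1 := by
  have := Complex.norm_exp_I_mul_ofReal (x * y)
  push_cast at this
  exact this

theorem norm_exp_I_mul_half (x y : ℝ) : ‖Complex.exp (Complex.I * (x * y / 2))‖ = 1 := by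
  have := Complex.norm_exp_I_mul_ofReal (x * y / 2)
  push_cast at this
  exact this

/-- Matrix elements of the Weyl operators are Fourier transforms, up to a phase. -/
theorem enorm_inner_weyl₀ (a b : ℝ) (h φ : L2R) :
    ‖⟪weyl₀ a b h, φ⟫_ℂ‖ₑ =
      ‖𝓕 (fun t : ℝ => (starRingEnd ℂ) (h (t + a)) * φ t) (b / (2 * Real.pi))‖ₑ := by
  have key : ⟪weyl₀ a b h, φ⟫_ℂ = (starRingEnd ℂ) (Complex.exp (Complex.I * (a * b / 2))) *
      𝓕 (fun t : ℝ => (starRingEnd ℂ) (h (t + a)) * φ t) (b / (2 * Real.pi)) := by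
    rw [L2.inner_def, Real.fourier_eq', ← integral_const_mul]
    refine integral_congr_ae ?_
    filter_upwards [coeFn_weyl₀ a b h] with t ht
    have e : (starRingEnd ℂ) (Complex.exp (Complex.I * (b * t))) =
        Complex.exp (↑(-2 * Real.pi * ⟪t, b / (2 * Real.pi)⟫_ℝ) * Complex.I) := by
      rw [← Complex.exp_conj]
      congr 1
      have : (-2 * Real.pi * ⟪t, b / (2 * Real.pi)⟫_ℝ) = -(b * t) := by
        simp only [RCLike.inner_apply, conj_trivial]
        field_simp
      rw [this]
      simp
      ring
    rw [ht, ← e]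
    simp only [RCLike.inner_apply, map_mul, smul_eq_mul]
    ring
  rw [key, enorm_mul]
  have : ‖(starRingEnd ℂ) (Complex.exp (Complex.I * (a * b / 2)))‖ₑ = 1 := by
    rw [← ofReal_norm, RCLike.norm_conj, norm_exp_I_mul_half]
    simp
  rw [this, one_mul]

theorem memLp_translate (h : L2R) (a : ℝ) : MemLp (fun t : ℝ => h (t + a)) 2 volume :=
  (Lp.memLp h).comp_measurePreserving (measurePreserving_add_right volume a)

theorem lintegral_enorm_sq_eq (h : L2R) : ∫⁻ t, ‖h t‖ₑ ^ 2 = ‖h‖ₑ ^ 2 := by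
  have := eLpNorm_nnreal_pow_eq_lintegral (f := h) (μ := (volume : Measure ℝ)) (p := 2)
      two_ne_zero
  rw [Lp.enorm_def]
  simpa using this.symm

/-- Plancherel in the momentum variable; the constant comes from the frequency being `c y / (2π)`.
Only almost every `a` is allowed: the product of `φ` with a translate of `h` is always integrable,
but Tonelli makes it square integrable only for almost all translates. -/
theorem lintegral_enorm_inner_weyl₀ (h φ : L2R) (c : ℝ) (hc : 0 < c) :
    ∀ᵐ a : ℝ, ∫⁻ y, ‖⟪weyl₀ a (c * y) h, φ⟫_ℂ‖ₑ ^ 2 =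
      ENNReal.ofReal (2 * Real.pi / c) * ∫⁻ t, ‖h (t + a)‖ₑ ^ 2 * ‖φ t‖ₑ ^ 2 := by
  have hm : Measurable fun z : ℝ × ℝ => ‖h (z.2 + z.1)‖ₑ ^ 2 * ‖φ z.2‖ₑ ^ 2 := by
    have h1 := (Lp.stronglyMeasurable h).measurable
    have h2 := (Lp.stronglyMeasurable φ).measurable
    fun_prop
  have hfin : ∫⁻ a, ∫⁻ t, ‖h (t + a)‖ₑ ^ 2 * ‖φ t‖ₑ ^ 2 ≠ ∞ := by
    rw [lintegral_lintegral_swap hm.aemeasurable]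
    have : ∀ t, ∫⁻ a, ‖h (t + a)‖ₑ ^ 2 * ‖φ t‖ₑ ^ 2 = ‖h‖ₑ ^ 2 * ‖φ t‖ₑ ^ 2 := fun t => by
      rw [lintegral_mul_const' _ _ (by simp), lintegral_add_left_eq_self (fun a => ‖h a‖ₑ ^ 2),
        lintegral_enorm_sq_eq]
    simp_rw [this]
    rw [lintegral_const_mul' _ _ (by simp), lintegral_enorm_sq_eq]
    finiteness
  filter_upwards [ae_lt_top (by fun_prop) hfin] with a ha
  set g : ℝ → ℂ := fun t => (starRingEnd ℂ) (h (t + a)) * φ t with hg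
  have hs : MemLp (fun t : ℝ => (starRingEnd ℂ) (h (t + a))) 2 volume := (memLp_translate h a).star
  have g1 : Integrable g := hs.integrable_mul (Lp.memLp φ)
  have ge : ∀ t, ‖g t‖ₑ ^ 2 = ‖h (t + a)‖ₑ ^ 2 * ‖φ t‖ₑ ^ 2 := fun t => by
    rw [hg]
    simp only [enorm_mul, mul_pow, RCLike.enorm_conj]
  have g2 : MemLp g 2 volume := by
    refine ⟨g1.1, ?_⟩
    have := eLpNorm_nnreal_pow_eq_lintegral (f := g) (μ := (volume : Measure ℝ)) (p := 2)
      two_ne_zero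
    simp only [ENNReal.coe_ofNat, NNReal.coe_ofNat, ENNReal.rpow_ofNat, ge] at this
    rw [← this] at ha
    exact (ENNReal.pow_lt_top_iff.1 ha).resolve_right two_ne_zero
  have e : ∀ y, ‖⟪weyl₀ a (c * y) h, φ⟫_ℂ‖ₑ ^ 2 = ‖𝓕 g (c / (2 * Real.pi) * y)‖ₑ ^ 2 := fun y => by
    rw [enorm_inner_weyl₀, hg, mul_div_right_comm]
  simp_rw [e]
  rw [lintegral_comp_mul_left _ (by positivity) (fun x => ‖𝓕 g x‖ₑ ^ 2),
    lintegral_enorm_sq_fourier g1 g2, inv_div]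
  simp_rw [ge]

/-- The Fourier transform intertwines Weyl operators. -/
theorem fourierTransform_weyl₀ (q p : ℝ) (f : L2R) :
    Lp.fourierTransformₗᵢ ℝ ℂ (weyl₀ (-q) p f) =
      weyl₀ (-p / (2 * Real.pi)) (-(2 * Real.pi * q)) (Lp.fourierTransformₗᵢ ℝ ℂ f) := by
  -- Both sides are continuous in `f`, so Schwartz functions suffice; for them all transforms are
  -- honest integrals.
  refine (SchwartzMap.denseRange_toLpCLM (E := ℝ) (F := ℂ) (p := 2) (μ := volume)
    ENNReal.ofNat_ne_top).induction_on (p := fun f : L2R => Lp.fourierTransformₗᵢ ℝ ℂ (weyl₀ (-q) p f) =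
      weyl₀ (-p / (2 * Real.pi)) (-(2 * Real.pi * q)) (Lp.fourierTransformₗᵢ ℝ ℂ f)) f ?_ ?_
  · exact isClosed_eq ((LinearIsometryEquiv.continuous _).comp (LinearIsometry.continuous _))
      ((LinearIsometry.continuous _).comp (LinearIsometryEquiv.continuous _))
  intro s
  rw [SchwartzMap.toLpCLM_apply]
  set g : ℝ → ℂ := fun t : ℝ => Complex.exp (Complex.I * (((-q : ℝ) : ℂ) * p / 2)) *
      Complex.exp (Complex.I * (p * t)) * s (t + -q) with hg
  have e1 : (weyl₀ (-q) p (s.toLp 2) : ℝ → ℂ) =ᵐ[volume] g := by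
    filter_upwards [coeFn_weyl₀ (-q) p (s.toLp 2), (measurePreserving_add_right (volume : Measure ℝ)
      (-q)).quasiMeasurePreserving.ae (s.coeFn_toLp 2 volume)] with t h1 h2
    rw [h1, h2]
  have g2 : MemLp g 2 volume := (Lp.memLp _).ae_eq e1
  have g1 : Integrable g := by
    refine (s.integrable.comp_add_right (-q)).mono (by
      refine Continuous.aestronglyMeasurable ?_
      have := s.continuous
      fun_prop) (Eventually.of_forall fun t => ?_)
    rw [hg]
    simp only [norm_mul, norm_exp_I_mul, norm_exp_I_mul_half, one_mul, le_refl]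
  have e2 : weyl₀ (-q) p (s.toLp 2) = g2.toLp g := by
    refine Lp.ext (e1.trans g2.coeFn_toLp.symm)
  rw [e2]
  refine Lp.ext ?_
  have e3 : Lp.fourierTransformₗᵢ ℝ ℂ (s.toLp 2) = (𝓕 s : SchwartzMap ℝ ℂ).toLp 2 :=
    SchwartzMap.toLp_fourier_eq s
  rw [e3]
  filter_upwards [coeFn_fourierTransform_toLp g1 g2, coeFn_weyl₀ (-p / (2 * Real.pi))
    (-(2 * Real.pi * q)) ((𝓕 s : SchwartzMap ℝ ℂ).toLp 2),
    (measurePreserving_add_right (volume : Measure ℝ)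
      (-p / (2 * Real.pi))).quasiMeasurePreserving.ae ((𝓕 s : SchwartzMap ℝ ℂ).coeFn_toLp 2 volume)]
    with ξ h1 h2 h3
  rw [h1, h2, h3, SchwartzMap.fourier_coe, Real.fourier_eq', Real.fourier_eq',
    ← integral_add_right_eq_self _ q, ← integral_const_mul]
  refine integral_congr_ae (Eventually.of_forall fun t => ?_)
  simp only [hg, smul_eq_mul, RCLike.inner_apply, conj_trivial, add_neg_cancel_right]
  simp only [← mul_assoc, ← Complex.exp_add]
  congr 2
  have hpi : (Real.pi : ℂ) ≠ 0 := by exact_mod_cast Real.pi_ne_zero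
  push_cast
  field_simp
  ring

/-- In modulus the matrix element is a parameter integral of a jointly measurable function, which
gives joint measurability. -/
theorem measurable_enorm_inner_weyl₀ (h φ : L2R) :
    Measurable fun z : ℝ × ℝ => ‖⟪weyl₀ z.1 z.2 h, φ⟫_ℂ‖ₑ := by
  simp_rw [enorm_inner_weyl₀, Real.fourier_eq']
  have h1 := (Lp.stronglyMeasurable h).measurable
  have h2 := (Lp.stronglyMeasurable φ).measurable
  have : StronglyMeasurable fun z : (ℝ × ℝ) × ℝ =>
      Complex.exp (↑(-2 * Real.pi * ⟪z.2, z.1.2 / (2 * Real.pi)⟫_ℝ) * Complex.I) •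
        ((starRingEnd ℂ) (h (z.2 + z.1.1)) * φ z.2) := by
    refine Measurable.stronglyMeasurable ?_
    have hE : Measurable fun z : (ℝ × ℝ) × ℝ =>
        Complex.exp (↑(-2 * Real.pi * ⟪z.2, z.1.2 / (2 * Real.pi)⟫_ℝ) * Complex.I) := by
      simp only [RCLike.inner_apply, conj_trivial]
      fun_prop
    refine hE.smul ?_
    have hA : Measurable fun z : (ℝ × ℝ) × ℝ => h (z.2 + z.1.1) := by fun_prop
    exact (Complex.continuous_conj.measurable.comp hA).mul (by fun_prop)
  exact this.integral_prod_right'.measurable.enorm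

/-- The weighted square integral over phase space of the matrix elements of the Weyl operators. -/
theorem lintegral_mul_enorm_inner_weyl₀_sq (h φ : L2R) {c : ℝ} (hc : 0 < c) {u : ℝ → ℝ≥0∞}
    (hu : Measurable u) :
    ∫⁻ z : ℝ × ℝ, u z.1 * ‖⟪weyl₀ (-z.1 / c) (c * z.2) h, φ⟫_ℂ‖ₑ ^ 2 =
      ENNReal.ofReal (2 * Real.pi) *
        ∫⁻ t, ∫⁻ s, u (c * (t - s)) * (‖h s‖ₑ ^ 2 * ‖φ t‖ₑ ^ 2) := by
  have hm : Measurable fun z : ℝ × ℝ => ‖⟪weyl₀ (-z.1 / c) (c * z.2) h, φ⟫_ℂ‖ₑ :=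
    Measurable.comp (g := fun z : ℝ × ℝ => ‖⟪weyl₀ z.1 z.2 h, φ⟫_ℂ‖ₑ)
      (f := fun z : ℝ × ℝ => (-z.1 / c, c * z.2)) (measurable_enorm_inner_weyl₀ h φ) (by fun_prop)
  have h1 := (Lp.stronglyMeasurable h).measurable
  have h2 := (Lp.stronglyMeasurable φ).measurable
  have hm' : Measurable fun z : ℝ × ℝ => u (c * z.1) * (‖h (z.2 - z.1)‖ₑ ^ 2 * ‖φ z.2‖ₑ ^ 2) := by
    fun_prop
  have hc' : ENNReal.ofReal c * ENNReal.ofReal c⁻¹ = 1 := by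
    rw [← ENNReal.ofReal_mul hc.le, mul_inv_cancel₀ hc.ne', ENNReal.ofReal_one]
  -- Rescaling position by `c` produces a factor that cancels the `1/c` from Plancherel in the
  -- rescaled momentum, leaving `2π` for every `c`.
  have hsub : ∀ F : ℝ → ℝ≥0∞, ∫⁻ x, F x = ENNReal.ofReal c * ∫⁻ x, F (c * x) := fun F => by
    rw [lintegral_comp_mul_left c hc, ← mul_assoc, hc', one_mul]
  have hu' : Measurable fun z : ℝ × ℝ =>
      u z.1 * ‖⟪weyl₀ (-z.1 / c) (c * z.2) h, φ⟫_ℂ‖ₑ ^ 2 := by fun_prop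
  rw [Measure.volume_eq_prod, lintegral_prod _ hu'.aemeasurable, hsub]
  have hae : ∀ᵐ x : ℝ, ∫⁻ y, u (c * x) * ‖⟪weyl₀ (-(c * x) / c) (c * y) h, φ⟫_ℂ‖ₑ ^ 2 =
      ENNReal.ofReal (2 * Real.pi / c) *
        ∫⁻ t, u (c * x) * (‖h (t - x)‖ₑ ^ 2 * ‖φ t‖ₑ ^ 2) := by
    have hneg : ∀ᵐ x : ℝ, ∫⁻ y, ‖⟪weyl₀ (-x) (c * y) h, φ⟫_ℂ‖ₑ ^ 2 =
        ENNReal.ofReal (2 * Real.pi / c) * ∫⁻ t, ‖h (t + -x)‖ₑ ^ 2 * ‖φ t‖ₑ ^ 2 :=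
      (Measure.measurePreserving_neg (volume : Measure ℝ)).quasiMeasurePreserving.ae
        (p := fun a => ∫⁻ y, ‖⟪weyl₀ a (c * y) h, φ⟫_ℂ‖ₑ ^ 2 =
          ENNReal.ofReal (2 * Real.pi / c) * ∫⁻ t, ‖h (t + a)‖ₑ ^ 2 * ‖φ t‖ₑ ^ 2)
        (lintegral_enorm_inner_weyl₀ h φ c hc)
    filter_upwards [hneg] with x hx
    have e : -(c * x) / c = -x := by field_simp
    rw [e, lintegral_const_mul _ (by
      exact (Measurable.comp (g := fun z : ℝ × ℝ => ‖⟪weyl₀ z.1 z.2 h, φ⟫_ℂ‖ₑ)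
        (f := fun y : ℝ => (-x, c * y)) (measurable_enorm_inner_weyl₀ h φ)
        (by fun_prop)).pow_const 2), hx,
      lintegral_const_mul _ (by fun_prop)]
    simp_rw [← sub_eq_add_neg]
    ring
  rw [lintegral_congr_ae hae, lintegral_const_mul _ (by fun_prop), ← mul_assoc,
    ← ENNReal.ofReal_mul hc.le, mul_div_cancel₀ _ hc.ne', lintegral_lintegral_swap hm'.aemeasurable]
  congr 1
  refine lintegral_congr fun t => ?_
  -- Substitute `s = t - x` for fixed `t`.
  rw [← lintegral_sub_left_eq_self _ t]
  simp

/-! ### Hilbert–Schmidt and trace class operators. -/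

section HilbertSchmidt

variable {ι H : Type*} [NormedAddCommGroup H] [InnerProductSpace ℂ H]

theorem HilbertBasis.hasSum_norm_inner_sq (b : HilbertBasis ι ℂ H) (x : H) :
    HasSum (fun i => ‖⟪b i, x⟫_ℂ‖ ^ 2) (‖x‖ ^ 2) := by
  have := (b.hasSum_inner_mul_inner x x).mapL Complex.reCLM
  rw [inner_self_eq_norm_sq_to_K] at this
  convert! this using 1
  · ext i
    simp only [Complex.reCLM_apply]
    rw [← inner_conj_symm x, ← Complex.normSq_eq_conj_mul_self, Complex.ofReal_re,
      Complex.normSq_eq_norm_sq]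
  · rw [Complex.reCLM_apply]
    norm_cast

theorem HilbertBasis.tsum_enorm_inner_sq (b : HilbertBasis ι ℂ H) (x : H) :
    ∑' i, ‖⟪b i, x⟫_ℂ‖ₑ ^ 2 = ‖x‖ₑ ^ 2 := by
  have h := b.hasSum_norm_inner_sq x
  have := ENNReal.ofReal_tsum_of_nonneg (fun i => by positivity) h.summable
  rw [h.tsum_eq] at this
  simp only [← ofReal_norm, ← ENNReal.ofReal_pow (norm_nonneg _)]
  exact this.symm

/-- Distinct basis vectors are at distance `√2`, so balls of radius `1/2` around them are disjoint.
Countability is what allows sums over the basis to be measurable and to be exchanged with integrals.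
-/
theorem HilbertBasis.countable [TopologicalSpace.SeparableSpace H] (b : HilbertBasis ι ℂ H) :
    Countable ι := by
  refine Pairwise.countable_of_isOpen_disjoint (s := fun i => Metric.ball (b i) (1 / 2)) ?_
    (fun i => Metric.isOpen_ball) fun i => ⟨b i, Metric.mem_ball_self (by norm_num)⟩
  intro i j hij
  refine Metric.ball_disjoint_ball ?_
  have h1 : ‖b i - b j‖ ^ 2 = 2 := by
    rw [@norm_sub_sq ℂ, b.orthonormal.1 i, b.orthonormal.1 j, b.orthonormal.2 hij]
    norm_num
  rw [dist_eq_norm]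
  nlinarith [norm_nonneg (b i - b j)]

theorem summable_norm_inner_sq_prod (b : HilbertBasis ι ℂ H) {Z : H →L[ℂ] H}
    (hZ : Summable fun i => ‖Z (b i)‖ ^ 2) :
    Summable fun p : ι × ι => ‖⟪b p.2, Z (b p.1)⟫_ℂ‖ ^ 2 := by
  refine (summable_prod_of_nonneg (f := fun p : ι × ι => ‖⟪b p.2, Z (b p.1)⟫_ℂ‖ ^ 2)
    (fun p => sq_nonneg _)).2 ⟨fun i => (b.hasSum_norm_inner_sq (Z (b i))).summable, ?_⟩
  simp only [fun i => (b.hasSum_norm_inner_sq (Z (b i))).tsum_eq]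
  exact hZ

variable [CompleteSpace H]

/-- By Parseval both sides sum the squared matrix entries, by rows and by columns. -/
theorem tsum_enorm_sq_adjoint (b : HilbertBasis ι ℂ H) (S : H →L[ℂ] H) :
    ∑' i, ‖(ContinuousLinearMap.adjoint S) (b i)‖ₑ ^ 2 = ∑' i, ‖S (b i)‖ₑ ^ 2 := by
  simp_rw [← b.tsum_enorm_inner_sq]
  rw [ENNReal.tsum_comm]
  refine tsum_congr fun i => tsum_congr fun j => ?_
  rw [ContinuousLinearMap.adjoint_inner_right, ← inner_conj_symm, RCLike.enorm_conj]

theorem summable_norm_sq_iff {E : Type*} [SeminormedAddCommGroup E] (f : ι → E) :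
    Summable (fun i => ‖f i‖ ^ 2) ↔ ∑' i, ‖f i‖ₑ ^ 2 ≠ ∞ := by
  have : ∀ i, ‖f i‖ₑ ^ 2 = ((‖f i‖₊ ^ 2 : NNReal) : ℝ≥0∞) := fun i => by
    rw [ENNReal.coe_pow]; rfl
  simp_rw [this]
  rw [ENNReal.tsum_coe_ne_top_iff_summable, ← NNReal.summable_coe]
  simp

theorem summable_norm_sq_adjoint (b : HilbertBasis ι ℂ H) {S : H →L[ℂ] H}
    (h : Summable fun i => ‖S (b i)‖ ^ 2) :
    Summable fun i => ‖(ContinuousLinearMap.adjoint S) (b i)‖ ^ 2 := by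
  rw [summable_norm_sq_iff] at h ⊢
  rwa [tsum_enorm_sq_adjoint]

theorem tsum_norm_sq_adjoint (b : HilbertBasis ι ℂ H) {S : H →L[ℂ] H}
    (h : Summable fun i => ‖S (b i)‖ ^ 2) :
    ∑' i, ‖(ContinuousLinearMap.adjoint S) (b i)‖ ^ 2 = ∑' i, ‖S (b i)‖ ^ 2 := by
  have h' := summable_norm_sq_adjoint b h
  rw [← ENNReal.ofReal_eq_ofReal_iff (tsum_nonneg fun i => by positivity)
    (tsum_nonneg fun i => by positivity), ENNReal.ofReal_tsum_of_nonneg (fun i => by positivity) h,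
    ENNReal.ofReal_tsum_of_nonneg (fun i => by positivity) h']
  simp only [ENNReal.ofReal_pow (norm_nonneg _), ofReal_norm]
  exact tsum_enorm_sq_adjoint b S

/-- The Hilbert-Schmidt inner product is invariant under taking adjoints. -/
theorem tsum_inner_adjoint (b : HilbertBasis ι ℂ H) {X Y : H →L[ℂ] H}
    (hX : Summable fun i => ‖X (b i)‖ ^ 2) (hY : Summable fun i => ‖Y (b i)‖ ^ 2) :
    ∑' i, ⟪X (b i), Y (b i)⟫_ℂ =
      ∑' j, ⟪(ContinuousLinearMap.adjoint Y) (b j), (ContinuousLinearMap.adjoint X) (b j)⟫_ℂ := by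
  let f : ι → ι → ℂ := fun i j => ⟪X (b i), b j⟫_ℂ * ⟪b j, Y (b i)⟫_ℂ
  have h2 : Summable (Function.uncurry f) := by
    refine Summable.of_norm_bounded ((summable_norm_inner_sq_prod b hX).add
      (summable_norm_inner_sq_prod b hY)) fun p => ?_
    change ‖⟪X (b p.1), b p.2⟫_ℂ * ⟪b p.2, Y (b p.1)⟫_ℂ‖ ≤ _
    rw [norm_mul, norm_inner_symm]
    have h := two_mul_le_add_sq ‖⟪b p.2, X (b p.1)⟫_ℂ‖ ‖⟪b p.2, Y (b p.1)⟫_ℂ‖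
    have h' := mul_nonneg (norm_nonneg ⟪b p.2, X (b p.1)⟫_ℂ) (norm_nonneg ⟪b p.2, Y (b p.1)⟫_ℂ)
    linarith
  have e1 : ∀ i, ⟪X (b i), Y (b i)⟫_ℂ = ∑' j, f i j := fun i =>
    (b.tsum_inner_mul_inner (X (b i)) (Y (b i))).symm
  have e2 : ∀ j, ⟪(ContinuousLinearMap.adjoint Y) (b j), (ContinuousLinearMap.adjoint X) (b j)⟫_ℂ =
      ∑' i, f i j := fun j => by
    rw [← b.tsum_inner_mul_inner ((ContinuousLinearMap.adjoint Y) (b j))]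
    refine tsum_congr fun i => ?_
    rw [ContinuousLinearMap.adjoint_inner_left, ContinuousLinearMap.adjoint_inner_right, mul_comm]
  rw [tsum_congr e1, tsum_congr e2]
  exact h2.tsum_comm.symm

/-- Both squares equal `⟪x, C* C x⟫`, since `|C|² = C* C`. -/
theorem norm_cfcAbs_apply (C : H →L[ℂ] H) (x : H) : ‖CFC.abs C x‖ = ‖C x‖ := by
  have hA : (CFC.abs C).IsPositive :=
    (ContinuousLinearMap.nonneg_iff_isPositive _).1 (CFC.abs_nonneg C)
  have h : ⟪CFC.abs C x, CFC.abs C x⟫_ℂ = ⟪C x, C x⟫_ℂ := by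
    have h1 : ⟪CFC.abs C x, CFC.abs C x⟫_ℂ = ⟪x, CFC.abs C (CFC.abs C x)⟫_ℂ := hA.isSymmetric x _
    have h2 : CFC.abs C (CFC.abs C x) = (ContinuousLinearMap.adjoint C) (C x) :=
      congrArg (fun D : H →L[ℂ] H => D x) (CFC.abs_mul_abs C)
    rw [h1, h2, ContinuousLinearMap.adjoint_inner_right]
  rw [inner_self_eq_norm_sq_to_K, inner_self_eq_norm_sq_to_K] at h
  norm_cast at h
  exact (sq_eq_sq₀ (norm_nonneg _) (norm_nonneg _)).1 h

/-- The product of two Hilbert-Schmidt operators is of trace class. -/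
theorem summable_inner_cfcAbs_comp (b : HilbertBasis ι ℂ H) {B S : H →L[ℂ] H}
    (hB : Summable fun i => ‖B (b i)‖ ^ 2) (hS : Summable fun i => ‖S (b i)‖ ^ 2) :
    Summable fun i => (⟪b i, CFC.abs (B ∘L S) (b i)⟫_ℂ).re := by
  set C := B ∘L S with hC
  set A := CFC.abs C with hAC
  have hA0 : 0 ≤ A := CFC.abs_nonneg C
  have hA : A.IsPositive := (ContinuousLinearMap.nonneg_iff_isPositive _).1 hA0
  have hsymm : ∀ x y, ⟪A x, y⟫_ℂ = ⟪x, A y⟫_ℂ := fun x y => hA.isSymmetric x y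
  have hAA : ∀ x, A (A x) = (ContinuousLinearMap.adjoint C) (C x) := fun x => by
    have := CFC.abs_mul_abs C
    exact congrArg (fun D : H →L[ℂ] H => D x) this
  set K := ∑' i, ‖S (b i)‖ ^ 2 + ∑' i, ‖B (b i)‖ ^ 2 with hK
  refine summable_of_sum_le (c := K) (fun i => (Complex.le_def.1 (hA.inner_nonneg_right _)).1)
    fun F => ?_
  refine le_of_forall_pos_le_add fun δ hδ => ?_
  -- Each basis vector in `F` will cost an error `ε`, so the total error stays below `δ`.
  set ε : ℝ := δ / (F.card + 1) with hε
  have hε0 : 0 < ε := by positivity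
  have hu : IsUnit (A + algebraMap ℝ (H →L[ℂ] H) ε) := by
    nontriviality (H →L[ℂ] H)
    exact (IsStrictlyPositive.nonneg_add hA0 (isStrictlyPositive_algebraMap hε0)).isUnit
  -- The resolvent `R = (|C| + ε)⁻¹` replaces the polar decomposition: the contraction `D = C R`
  -- approximates the partial isometry, and `|C| = C* D + ε |C| R` with `|C| R` a contraction.
  obtain ⟨R, hR⟩ : ∃ R : H →L[ℂ] H, ∀ x, A (R x) + (ε : ℂ) • R x = x := by
    obtain ⟨v, hv⟩ := hu
    refine ⟨(v⁻¹ : (H →L[ℂ] H)ˣ), fun x => ?_⟩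
    have := congrArg (fun D : H →L[ℂ] H => D x) v.mul_inv
    rw [hv] at this
    simpa [Algebra.algebraMap_eq_smul_one] using! this
  have hRA : ∀ x, ‖A (R x)‖ ≤ ‖x‖ := fun x => by
    have h1 : ‖x‖ ^ 2 = ‖A (R x)‖ ^ 2 + 2 * (ε * (⟪A (R x), R x⟫_ℂ).re) + (ε * ‖R x‖) ^ 2 := by
      conv_lhs => rw [← hR x]
      rw [@norm_add_sq ℂ, inner_smul_right, norm_smul]
      simp [abs_of_pos hε0]
    have h2 : 0 ≤ (⟪A (R x), R x⟫_ℂ).re := (Complex.le_def.1 (hA.inner_nonneg_left _)).1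
    have := mul_nonneg hε0.le h2
    refine (sq_le_sq₀ (norm_nonneg _) (norm_nonneg _)).1 ?_
    nlinarith [sq_nonneg (ε * ‖R x‖)]
  set D := C ∘L R with hD
  have hDn : ‖D‖ ≤ 1 := by
    refine ContinuousLinearMap.opNorm_le_bound _ zero_le_one fun x => ?_
    rw [one_mul]
    change ‖C (R x)‖ ≤ _
    rw [← norm_cfcAbs_apply]
    exact hRA x
  -- Since `C = B S`, one has `⟪e, C* D e⟫ = ⟪S e, B* D e⟫`. The Hilbert–Schmidt norm of `B* D` is
  -- at most that of `B`, as seen on its adjoint `D* B`.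
  set Y := (ContinuousLinearMap.adjoint B) ∘L D with hY
  have hYa : ContinuousLinearMap.adjoint Y = (ContinuousLinearMap.adjoint D) ∘L B := by
    rw [hY, ContinuousLinearMap.adjoint_comp, ContinuousLinearMap.adjoint_adjoint]
  have hle : ∀ i, ‖(ContinuousLinearMap.adjoint Y) (b i)‖ ^ 2 ≤ ‖B (b i)‖ ^ 2 := fun i => by
    rw [hYa]
    refine pow_le_pow_left₀ (norm_nonneg _) ?_ 2
    refine (ContinuousLinearMap.le_opNorm (ContinuousLinearMap.adjoint D) (B (b i))).trans ?_
    rw [LinearIsometryEquiv.norm_map]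
    exact mul_le_of_le_one_left (norm_nonneg _) hDn
  have hsY' : Summable fun i => ‖(ContinuousLinearMap.adjoint Y) (b i)‖ ^ 2 :=
    Summable.of_nonneg_of_le (fun i => by positivity) hle hB
  have hsY : Summable fun i => ‖Y (b i)‖ ^ 2 := by
    have := summable_norm_sq_adjoint b hsY'
    rwa [ContinuousLinearMap.adjoint_adjoint] at this
  have hYB : ∑' i, ‖Y (b i)‖ ^ 2 ≤ ∑' i, ‖B (b i)‖ ^ 2 := by
    rw [← tsum_norm_sq_adjoint b hsY]
    exact hsY'.tsum_le_tsum hle hB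
  have key : ∀ i, (⟪b i, A (b i)⟫_ℂ).re ≤ ‖S (b i)‖ ^ 2 + ‖Y (b i)‖ ^ 2 + ε := fun i => by
    have e : ⟪b i, A (b i)⟫_ℂ = ⟪S (b i), Y (b i)⟫_ℂ + ε * ⟪b i, A (R (b i))⟫_ℂ := by
      have h1 : A (b i) = A (A (R (b i))) + (ε : ℂ) • A (R (b i)) := by
        conv_lhs => rw [← hR (b i)]
        simp
      rw [h1, inner_add_right, inner_smul_right, hAA, ContinuousLinearMap.adjoint_inner_right, hY]
      congr 1
      change _ = ⟪S (b i), (ContinuousLinearMap.adjoint B) (D (b i))⟫_ℂ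
      rw [ContinuousLinearMap.adjoint_inner_right]
      rfl
    have n1 := norm_inner_le_norm (𝕜 := ℂ) (S (b i)) (Y (b i))
    have n2 := norm_inner_le_norm (𝕜 := ℂ) (b i) (A (R (b i)))
    have n3 := hRA (b i)
    rw [b.orthonormal.1 i] at n2 n3
    have r1 := Complex.re_le_norm ⟪S (b i), Y (b i)⟫_ℂ
    have r2 := Complex.re_le_norm ⟪b i, A (R (b i))⟫_ℂ
    rw [e, Complex.add_re, Complex.re_ofReal_mul]
    have : ε * (⟪b i, A (R (b i))⟫_ℂ).re ≤ ε * 1 :=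
      mul_le_mul_of_nonneg_left (by linarith) hε0.le
    nlinarith [sq_nonneg (‖S (b i)‖ - ‖Y (b i)‖), sq_nonneg ‖S (b i)‖, sq_nonneg ‖Y (b i)‖]
  calc ∑ i ∈ F, (⟪b i, A (b i)⟫_ℂ).re
      ≤ ∑ i ∈ F, (‖S (b i)‖ ^ 2 + ‖Y (b i)‖ ^ 2 + ε) := Finset.sum_le_sum fun i _ => key i
    _ = ∑ i ∈ F, ‖S (b i)‖ ^ 2 + ∑ i ∈ F, ‖Y (b i)‖ ^ 2 + F.card * ε := by
        simp [Finset.sum_add_distrib]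
    _ ≤ K + δ := by
        have h1 := hS.sum_le_tsum F (fun i _ => by positivity)
        have h2 := hsY.sum_le_tsum F (fun i _ => by positivity)
        have h3 : F.card * ε ≤ δ := by
          rw [hε, mul_div_assoc', div_le_iff₀ (by positivity)]
          nlinarith
        linarith

end HilbertSchmidt

/-! ### Powers of a multiplication operator and polynomials in it. -/

section Powers

variable {H : Type*} [NormedAddCommGroup H] [InnerProductSpace ℂ H]

/-- Domination by `|x|ʲ ≤ 1 + |x|ᵏ`. -/
theorem memLp_ofReal_pow_mul {f : ℝ → ℂ} {c : ℝ} {j k : ℕ} (hjk : j ≤ k) (hf : MemLp f 2 volume)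
    (hk : MemLp (fun t : ℝ => ((c * t : ℝ) : ℂ) ^ k * f t) 2 volume) :
    MemLp (fun t : ℝ => ((c * t : ℝ) : ℂ) ^ j * f t) 2 volume := by
  refine (hf.norm.add hk.norm).of_le ?_ (Eventually.of_forall fun t => ?_)
  · exact (by fun_prop : Continuous fun t : ℝ => ((c * t : ℝ) : ℂ) ^ j).aestronglyMeasurable.mul hf.1
  · rw [Pi.add_apply, norm_mul, norm_mul, norm_pow, norm_pow, Complex.norm_real]
    refine le_trans ?_ (le_abs_self _)
    have : ‖c * t‖ ^ j ≤ 1 + ‖c * t‖ ^ k := by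
      rcases le_total ‖c * t‖ 1 with h | h
      · have := pow_le_one₀ (n := j) (norm_nonneg _) h
        have := pow_nonneg (norm_nonneg (c * t)) k
        linarith
      · have := pow_le_pow_right₀ h hjk
        linarith
    nlinarith [norm_nonneg (f t)]

theorem mem_position_domain (f : L2R) :
    f ∈ position.domain ↔ MemLp (fun t : ℝ => (t : ℂ) * f t) 2 volume := Iff.rfl

theorem coeFn_position (f : position.domain) :
    (position f : ℝ → ℂ) =ᵐ[volume] fun t : ℝ => (t : ℂ) * (f : L2R) t :=
  MemLp.coeFn_toLp ((mem_position_domain f).1 f.2)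

/-- The multiplication operator by `c t`, carried over to `H` by a unitary map. -/
noncomputable abbrev scaledPosition (V : L2R ≃ₗᵢ[ℂ] H) (c : ℝ) : H →ₗ.[ℂ] H :=
  transport V ((c : ℂ) • position)

theorem mem_scaledPosition_domain (V : L2R ≃ₗᵢ[ℂ] H) {c : ℝ} (hc : c ≠ 0) (φ : H) :
    φ ∈ (scaledPosition V c).domain ↔
      MemLp (fun t : ℝ => ((c * t : ℝ) : ℂ) * V.symm φ t) 2 volume := by
  have e : φ ∈ (scaledPosition V c).domain ↔
      MemLp (fun t : ℝ => (t : ℂ) * V.symm φ t) 2 volume := Iff.rfl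
  have hc' : (c : ℂ) ≠ 0 := by exact_mod_cast hc
  rw [e]
  constructor <;> intro h
  · refine (h.const_mul (c : ℂ)).ae_eq (Eventually.of_forall fun t => ?_)
    push_cast
    ring
  · refine (h.const_mul (c : ℂ)⁻¹).ae_eq (Eventually.of_forall fun t => ?_)
    push_cast
    field_simp

theorem coeFn_scaledPosition (V : L2R ≃ₗᵢ[ℂ] H) (c : ℝ) (φ : (scaledPosition V c).domain) :
    (V.symm (scaledPosition V c φ) : ℝ → ℂ) =ᵐ[volume]
      fun t : ℝ => ((c * t : ℝ) : ℂ) * V.symm (φ : H) t := by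
  have e : V.symm (scaledPosition V c φ) =
      (c : ℂ) • position ⟨V.symm (φ : H), φ.2⟩ := V.symm_apply_apply _
  rw [e]
  filter_upwards [Lp.coeFn_smul (c : ℂ) (position ⟨V.symm (φ : H), φ.2⟩),
    coeFn_position ⟨V.symm (φ : H), φ.2⟩] with t h1 h2
  rw [h1, Pi.smul_apply, h2]
  push_cast
  simp only [smul_eq_mul]
  ring

/-- Domain and action are proved in one induction, because the natural domain of the next power
depends on the values of the previous one. It is no smaller than the maximal domain of the
multiplication operator, as lower powers are controlled by higher ones. -/
theorem powOp_scaledPosition (V : L2R ≃ₗᵢ[ℂ] H) {c : ℝ} (hc : c ≠ 0) (k : ℕ) (φ : H) :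
    (φ ∈ (powOp (scaledPosition V c) k).domain ↔
      MemLp (fun t : ℝ => ((c * t : ℝ) : ℂ) ^ k * V.symm φ t) 2 volume) ∧
    ∀ h : φ ∈ (powOp (scaledPosition V c) k).domain,
      (V.symm (powOp (scaledPosition V c) k ⟨φ, h⟩) : ℝ → ℂ) =ᵐ[volume]
        fun t : ℝ => ((c * t : ℝ) : ℂ) ^ k * V.symm φ t := by
  induction k with
  | zero =>
    refine ⟨⟨fun _ => ?_, fun _ => trivial⟩, fun _ => ?_⟩
    · simpa using Lp.memLp (V.symm φ)
    · refine Eventually.of_forall fun t => ?_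
      change V.symm φ t = _
      simp
  | succ k ih =>
    have hval : ∀ h : φ ∈ (powOp (scaledPosition V c) k).domain,
        (fun t : ℝ => ((c * t : ℝ) : ℂ) * V.symm (powOp (scaledPosition V c) k ⟨φ, h⟩) t) =ᵐ[volume]
          fun t : ℝ => ((c * t : ℝ) : ℂ) ^ (k + 1) * V.symm φ t := fun h => by
      filter_upwards [ih.2 h] with t ht
      rw [ht]
      ring
    refine ⟨⟨?_, fun h => ?_⟩, ?_⟩
    · rintro ⟨h, h'⟩
      exact ((mem_scaledPosition_domain V hc _).1 h').ae_eq (hval h)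
    · have hk := ih.1.2 (memLp_ofReal_pow_mul k.le_succ (Lp.memLp _) h)
      exact ⟨hk, (mem_scaledPosition_domain V hc _).2 (h.ae_eq (hval hk).symm)⟩
    · rintro ⟨h, h'⟩
      exact (coeFn_scaledPosition V c ⟨_, h'⟩).trans (hval h)

theorem mem_powOp_scaledPosition (V : L2R ≃ₗᵢ[ℂ] H) {c : ℝ} (hc : c ≠ 0) {k : ℕ} {φ : H} :
    φ ∈ (powOp (scaledPosition V c) k).domain ↔
      MemLp (fun t : ℝ => ((c * t : ℝ) : ℂ) ^ k * V.symm φ t) 2 volume :=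
  (powOp_scaledPosition V hc k φ).1

theorem coeFn_powOp_scaledPosition (V : L2R ≃ₗᵢ[ℂ] H) {c : ℝ} (hc : c ≠ 0) {k : ℕ}
    (φ : (powOp (scaledPosition V c) k).domain) :
    (V.symm (powOp (scaledPosition V c) k φ) : ℝ → ℂ) =ᵐ[volume]
        fun t : ℝ => ((c * t : ℝ) : ℂ) ^ k * V.symm (φ : H) t :=
  (powOp_scaledPosition V hc k φ).2 φ.2

theorem mem_powOp_of_le (V : L2R ≃ₗᵢ[ℂ] H) {c : ℝ} (hc : c ≠ 0) {j k : ℕ} (hjk : j ≤ k) {φ : H}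
    (h : φ ∈ (powOp (scaledPosition V c) k).domain) :
    φ ∈ (powOp (scaledPosition V c) j).domain :=
  (mem_powOp_scaledPosition V hc).2
    (memLp_ofReal_pow_mul hjk (Lp.memLp _) ((mem_powOp_scaledPosition V hc).1 h))

theorem enorm_sq_eq_lintegral (V : L2R ≃ₗᵢ[ℂ] H) (φ : H) :
    ‖φ‖ₑ ^ 2 = ∫⁻ t, ‖V.symm φ t‖ₑ ^ 2 := by
  rw [lintegral_enorm_sq_eq, ← ofReal_norm, ← ofReal_norm, LinearIsometryEquiv.norm_map]

/-- Integrates `|x|²ʲ ≤ 1 + |x|²ᵏ` against the density of `φ`. -/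
theorem norm_sq_powOp_le (V : L2R ≃ₗᵢ[ℂ] H) {c : ℝ} (hc : c ≠ 0) {j k : ℕ} (hjk : j ≤ k) {φ : H}
    (hj : φ ∈ (powOp (scaledPosition V c) j).domain)
    (hk : φ ∈ (powOp (scaledPosition V c) k).domain) :
    ‖powOp (scaledPosition V c) j ⟨φ, hj⟩‖ ^ 2 ≤
      ‖φ‖ ^ 2 + ‖powOp (scaledPosition V c) k ⟨φ, hk⟩‖ ^ 2 := by
  rw [← ENNReal.ofReal_le_ofReal_iff (by positivity), ENNReal.ofReal_add (by positivity)
    (by positivity)]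
  simp only [ENNReal.ofReal_pow (norm_nonneg _), ofReal_norm]
  rw [enorm_sq_eq_lintegral V, enorm_sq_eq_lintegral V φ, enorm_sq_eq_lintegral V,
    ← lintegral_add_left (by have := (Lp.stronglyMeasurable (V.symm φ)).measurable; fun_prop)]
  refine lintegral_mono_ae ?_
  filter_upwards [coeFn_powOp_scaledPosition V hc ⟨φ, hj⟩,
    coeFn_powOp_scaledPosition V hc ⟨φ, hk⟩] with t h1 h2
  rw [h1, h2]
  simp only [← ofReal_norm]
  rw [← ENNReal.ofReal_pow (norm_nonneg _), ← ENNReal.ofReal_pow (norm_nonneg _),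
    ← ENNReal.ofReal_pow (norm_nonneg _), ← ENNReal.ofReal_add (by positivity) (by positivity)]
  refine ENNReal.ofReal_le_ofReal ?_
  rw [norm_mul, norm_mul, norm_pow, norm_pow, Complex.norm_real, mul_pow, mul_pow]
  have : (‖c * t‖ ^ j) ^ 2 ≤ 1 + (‖c * t‖ ^ k) ^ 2 := by
    rcases le_total ‖c * t‖ 1 with h | h
    · have := pow_le_one₀ (n := 2) (by positivity) (pow_le_one₀ (n := j) (norm_nonneg _) h)
      have := sq_nonneg (‖c * t‖ ^ k)
      linarith
    · have := pow_le_pow_left₀ (by positivity) (pow_le_pow_right₀ h hjk) 2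
      linarith
  nlinarith [sq_nonneg ‖V.symm φ t‖]

/-- The pointwise bound on `C` makes it bounded and also lets it inherit the Hilbert–Schmidt
property from `S` and `B`. -/
theorem powOp_prod_ofBounded_eq (V : L2R ≃ₗᵢ[ℂ] H) {c : ℝ} (hc : c ≠ 0) {j k : ℕ} (hjk : j ≤ k)
    {S B : H →L[ℂ] H}
    (h : prodOp (powOp (scaledPosition V c) k) (ofBounded S) = ofBounded B) :
    ∃ C : H →L[ℂ] H, prodOp (powOp (scaledPosition V c) j) (ofBounded S) = ofBounded C ∧
      ∀ x, ‖C x‖ ^ 2 ≤ ‖S x‖ ^ 2 + ‖B x‖ ^ 2 := by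
  have hdk : ∀ x, S x ∈ (powOp (scaledPosition V c) k).domain := fun x => by
    have : x ∈ (ofBounded B).domain := trivial
    rw [← h] at this
    exact this.2
  have hvk : ∀ x, powOp (scaledPosition V c) k ⟨S x, hdk x⟩ = B x := fun x =>
    LinearPMap.ext_iff.1 h |>.2 (x := x) (hf := ⟨trivial, hdk x⟩) (hg := trivial)
  have hdj : ∀ x, S x ∈ (powOp (scaledPosition V c) j).domain := fun x =>
    mem_powOp_of_le V hc hjk (hdk x)
  let C₀ : H →ₗ[ℂ] H :=
    (prodOp (powOp (scaledPosition V c) j) (ofBounded S)).toFun ∘ₗ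
      LinearMap.codRestrict _ LinearMap.id fun x => ⟨trivial, hdj x⟩
  have hC₀ : ∀ x, C₀ x = powOp (scaledPosition V c) j ⟨S x, hdj x⟩ := fun x => rfl
  have hle : ∀ x, ‖C₀ x‖ ^ 2 ≤ ‖S x‖ ^ 2 + ‖B x‖ ^ 2 := fun x => by
    rw [hC₀, ← hvk]
    exact norm_sq_powOp_le V hc hjk (hdj x) (hdk x)
  refine ⟨C₀.mkContinuous (‖S‖ + ‖B‖) fun x => ?_, ?_, hle⟩
  · have h1 := S.le_opNorm x
    have h2 := B.le_opNorm x
    have h3 : ‖C₀ x‖ ≤ ‖S x‖ + ‖B x‖ := by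
      refine (sq_le_sq₀ (norm_nonneg _) (by positivity)).1 ((hle x).trans ?_)
      nlinarith [norm_nonneg (S x), norm_nonneg (B x)]
    linarith
  · exact LinearPMap.ext (by ext x; exact ⟨fun _ => trivial, fun _ => ⟨trivial, hdj x⟩⟩)
      fun x _ _ => rfl

theorem mem_domain_sum_smul {E F : Type*} [AddCommGroup E] [Module ℂ E] [AddCommGroup F]
    [Module ℂ F] (s : Finset ℕ) (a : ℕ → ℂ) (B : ℕ → E →ₗ.[ℂ] F) (φ : E) :
    φ ∈ (∑ l ∈ s, a l • B l).domain ↔ ∀ l ∈ s, φ ∈ (B l).domain := by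
  classical
  induction s using Finset.induction_on with
  | empty => simp
  | insert i s hi ih =>
    rw [Finset.sum_insert hi, LinearPMap.add_domain, Submodule.mem_inf, ih,
      LinearPMap.smul_domain, Finset.forall_mem_insert]

theorem sum_smul_apply {E F : Type*} [AddCommGroup E] [Module ℂ E] [AddCommGroup F]
    [Module ℂ F] (s : Finset ℕ) (a : ℕ → ℂ) (B : ℕ → E →ₗ.[ℂ] F) (φ : E) (v : ℕ → F)
    (hv : ∀ l ∈ s, ∀ h : φ ∈ (B l).domain, B l ⟨φ, h⟩ = v l)
    (h : φ ∈ (∑ l ∈ s, a l • B l).domain) :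
    (∑ l ∈ s, a l • B l) ⟨φ, h⟩ = ∑ l ∈ s, a l • v l := by
  classical
  induction s using Finset.induction_on with
  | empty => simp
  | insert i s hi ih =>
    have h1 := (mem_domain_sum_smul _ a B φ).1 h
    have h2 : φ ∈ (∑ l ∈ s, a l • B l).domain :=
      (mem_domain_sum_smul _ a B φ).2 fun l hl => h1 l (Finset.mem_insert_of_mem hl)
    have hi' := h1 i (Finset.mem_insert_self i s)
    have key : (∑ l ∈ insert i s, a l • B l) ⟨φ, h⟩ =
        (a i • B i + ∑ l ∈ s, a l • B l) ⟨φ, ⟨hi', h2⟩⟩ :=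
      (LinearPMap.ext_iff.1 (Finset.sum_insert (f := fun l => a l • B l) hi)).2
        (x := φ) (hf := h) (hg := ⟨hi', h2⟩)
    rw [key, Finset.sum_insert hi, ← ih (fun l hl => hv l (Finset.mem_insert_of_mem hl)) h2,
      ← hv i (Finset.mem_insert_self i s) hi']
    rfl

/-- The domains of the powers decrease, and a scalar factor, even `0`, leaves a domain unchanged;
the intersection is thus the domain of the top power. -/
theorem mem_momentPolynomial [CompleteSpace H] (V : L2R ≃ₗᵢ[ℂ] H) {c : ℝ} (hc : c ≠ 0)
    (T : H →L[ℂ] H) (k : ℕ) (φ : H) :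
    φ ∈ (momentPolynomial (scaledPosition V c) T k).domain ↔
      φ ∈ (powOp (scaledPosition V c) k).domain := by
  rw [momentPolynomial, mem_domain_sum_smul _ _ (fun l => powOp (scaledPosition V c) l)]
  exact ⟨fun h => h k (Finset.self_mem_range_succ k), fun h l hl =>
    mem_powOp_of_le V hc (Nat.lt_succ_iff.1 (Finset.mem_range.1 hl)) h⟩

theorem coeFn_sum_smul (s : Finset ℕ) (a : ℕ → ℂ) (g : ℕ → L2R) :
    (↑(∑ l ∈ s, a l • g l : L2R) : ℝ → ℂ) =ᵐ[volume] fun t => ∑ l ∈ s, a l * g l t := by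
  classical
  induction s using Finset.induction_on with
  | empty => simp only [Finset.sum_empty]; exact Lp.coeFn_zero ℂ 2 volume
  | insert i s hi ih =>
    rw [Finset.sum_insert hi]
    filter_upwards [Lp.coeFn_add (a i • g i) (∑ l ∈ s, a l • g l), ih,
      Lp.coeFn_smul (a i) (g i)] with t h1 h2 h3
    rw [h1, Pi.add_apply, h2, h3, Finset.sum_insert hi]
    rfl

theorem coeFn_momentPolynomial [CompleteSpace H] (V : L2R ≃ₗᵢ[ℂ] H) {c : ℝ} (hc : c ≠ 0)
    (T : H →L[ℂ] H) (k : ℕ) (φ : (momentPolynomial (scaledPosition V c) T k).domain) :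
    (V.symm (momentPolynomial (scaledPosition V c) T k φ) : ℝ → ℂ) =ᵐ[volume]
      fun t : ℝ => (∑ l ∈ Finset.range (k + 1), (k.choose l : ℂ) * (-1) ^ (k - l) *
        trace (prodOp (powOp (scaledPosition V c) (k - l)) (ofBounded T)) *
          ((c * t : ℝ) : ℂ) ^ l) * V.symm (φ : H) t := by
  classical
  obtain ⟨φ, h⟩ := φ
  have hl : ∀ l ∈ Finset.range (k + 1), φ ∈ (powOp (scaledPosition V c) l).domain :=
    (mem_domain_sum_smul _ _ (fun l => powOp (scaledPosition V c) l) _).1 h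
  -- The value `0` off the domain is never used; it frees the sum over `l` from membership proofs.
  set v : ℕ → H := fun l => if h : φ ∈ (powOp (scaledPosition V c) l).domain then
    powOp (scaledPosition V c) l ⟨φ, h⟩ else 0 with hv
  have e := sum_smul_apply (Finset.range (k + 1)) (fun l => (k.choose l : ℂ) * (-1) ^ (k - l) *
    trace (prodOp (powOp (scaledPosition V c) (k - l)) (ofBounded T)))
    (fun l => powOp (scaledPosition V c) l) φ v (fun l _ h => by simp [hv, h]) h
  have e' : V.symm (momentPolynomial (scaledPosition V c) T k ⟨φ, h⟩) =
      ∑ l ∈ Finset.range (k + 1), ((k.choose l : ℂ) * (-1) ^ (k - l) *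
        trace (prodOp (powOp (scaledPosition V c) (k - l)) (ofBounded T))) • V.symm (v l) := by
    refine (congrArg V.symm e).trans ?_
    rw [map_sum]
    simp only [map_smul]
  rw [e']
  have hae : ∀ᵐ t : ℝ, ∀ l ∈ Finset.range (k + 1),
      V.symm (v l) t = ((c * t : ℝ) : ℂ) ^ l * V.symm φ t := by
    refine (Finset.eventually_all _).2 fun l hl' => ?_
    have := coeFn_powOp_scaledPosition V hc ⟨φ, hl l hl'⟩
    rw [hv]
    simp only [hl l hl', dite_true]
    exact this
  filter_upwards [coeFn_sum_smul (Finset.range (k + 1)) (fun l => (k.choose l : ℂ) * (-1) ^ (k - l) *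
    trace (prodOp (powOp (scaledPosition V c) (k - l)) (ofBounded T))) (fun l => V.symm (v l)),
    hae] with t h1 h2
  rw [h1, Finset.sum_mul]
  refine Finset.sum_congr rfl fun l hl' => ?_
  rw [h2 l hl']
  ring

end Powers

/-- The finite measure `|f(t)|² dt`. -/
noncomputable def densityMeasure (f : L2R) : Measure ℝ := volume.withDensity fun t => ‖f t‖ₑ ^ 2

instance (f : L2R) : IsFiniteMeasure (densityMeasure f) := by
  refine ⟨?_⟩
  rw [densityMeasure, withDensity_apply _ MeasurableSet.univ, Measure.restrict_univ,
    lintegral_enorm_sq_eq]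
  finiteness

theorem lintegral_densityMeasure (f : L2R) {u : ℝ → ℝ≥0∞} (hu : Measurable u) :
    ∫⁻ t, u t ∂(densityMeasure f) = ∫⁻ t, u t * ‖f t‖ₑ ^ 2 := by
  have := (Lp.stronglyMeasurable f).measurable
  rw [densityMeasure, lintegral_withDensity_eq_lintegral_mul _ (by fun_prop) hu]
  refine lintegral_congr fun t => ?_
  rw [Pi.mul_apply, mul_comm]

/-! ### The phase space density and its marginal. -/

section PhaseSpaceDensity

variable {H : Type*} [NormedAddCommGroup H] [InnerProductSpace ℂ H]

/-- `V` brings the Weyl operators of `U` into the standard form, scaled by `c`, after the change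
of variables `R` of the phase space. -/
def Intertwines (U V : L2R ≃ₗᵢ[ℂ] H) (c : ℝ) (R : ℝ × ℝ → ℝ × ℝ) : Prop :=
  ∀ z h, weyl U (-z.1) z.2 (V h) = V (weyl₀ (-(R z).1 / c) (c * (R z).2) h)

theorem intertwines_id (U : L2R ≃ₗᵢ[ℂ] H) : Intertwines U U 1 id := fun z h => by
  change U (weyl₀ (-z.1) z.2 (U.symm (U h))) = _
  simp

variable [CompleteSpace H]

theorem countable_basisIndex (U : L2R ≃ₗᵢ[ℂ] H) : Countable (basisIndex H) := by
  have : Fact ((2 : ℝ≥0∞) ≠ ∞) := ⟨by simp⟩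
  have : TopologicalSpace.SeparableSpace H :=
    U.surjective.denseRange.separableSpace U.continuous
  exact (onb H).countable

/-- The sum of the measures `|V⁻¹ S eₙ|² dt` over an orthonormal basis `(eₙ)`. -/
noncomputable def rangeMeasure (V : L2R ≃ₗᵢ[ℂ] H) (S : H →L[ℂ] H) : Measure ℝ :=
  Measure.sum fun n => densityMeasure (V.symm (S (onb H n)))

theorem rangeMeasure_univ (V : L2R ≃ₗᵢ[ℂ] H) (S : H →L[ℂ] H) :
    rangeMeasure V S Set.univ = ∑' n, ‖S (onb H n)‖ₑ ^ 2 := by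
  rw [rangeMeasure, Measure.sum_apply _ MeasurableSet.univ]
  refine tsum_congr fun n => ?_
  rw [densityMeasure, withDensity_apply _ MeasurableSet.univ, Measure.restrict_univ,
    ← enorm_sq_eq_lintegral]

/-- The vector `S W(-q,p)* φ`. -/
noncomputable def translated (U : L2R ≃ₗᵢ[ℂ] H) (S : H →L[ℂ] H) (φ : H) (z : ℝ × ℝ) : H :=
  S (ContinuousLinearMap.adjoint (weyl U (-z.1) z.2) φ)

theorem translated_add (U : L2R ≃ₗᵢ[ℂ] H) (S : H →L[ℂ] H) (φ ψ : H) (z : ℝ × ℝ) :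
    translated U S (φ + ψ) z = translated U S φ z + translated U S ψ z := by
  simp [translated]

theorem translated_sub (U : L2R ≃ₗᵢ[ℂ] H) (S : H →L[ℂ] H) (φ ψ : H) (z : ℝ × ℝ) :
    translated U S (φ - ψ) z = translated U S φ z - translated U S ψ z := by
  simp [translated]

theorem translated_smul (U : L2R ≃ₗᵢ[ℂ] H) (S : H →L[ℂ] H) (a : ℂ) (φ : H) (z : ℝ × ℝ) :
    translated U S (a • φ) z = a • translated U S φ z := by
  simp [translated]

variable {U V : L2R ≃ₗᵢ[ℂ] H} {c : ℝ} {R : ℝ × ℝ → ℝ × ℝ}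

/-- Parseval together with `⟪eₙ, S W* φ⟫ = ⟪W S* eₙ, φ⟫`. -/
theorem enorm_sq_translated (hW : Intertwines U V c R) (S : H →L[ℂ] H) (φ : H) (z : ℝ × ℝ) :
    ‖translated U S φ z‖ₑ ^ 2 = ∑' n, ‖⟪weyl₀ (-(R z).1 / c) (c * (R z).2)
      (V.symm (ContinuousLinearMap.adjoint S (onb H n))), V.symm φ⟫_ℂ‖ₑ ^ 2 := by
  rw [← (onb H).tsum_enorm_inner_sq]
  refine tsum_congr fun n => ?_
  rw [translated, ← ContinuousLinearMap.adjoint_inner_left, ContinuousLinearMap.adjoint_inner_right]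
  have := hW z (V.symm (ContinuousLinearMap.adjoint S (onb H n)))
  rw [V.apply_symm_apply] at this
  rw [this, ← V.symm.inner_map_map, V.symm_apply_apply]

theorem measurable_enorm_inner_weyl₀_scaled (c : ℝ) (h φ : L2R) :
    Measurable fun z : ℝ × ℝ => ‖⟪weyl₀ (-z.1 / c) (c * z.2) h, φ⟫_ℂ‖ₑ :=
  Measurable.comp (g := fun z : ℝ × ℝ => ‖⟪weyl₀ z.1 z.2 h, φ⟫_ℂ‖ₑ)
    (f := fun z : ℝ × ℝ => (-z.1 / c, c * z.2)) (measurable_enorm_inner_weyl₀ h φ) (by fun_prop)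

theorem measurable_norm_sq_translated (U : L2R ≃ₗᵢ[ℂ] H) (S : H →L[ℂ] H) (φ : H) :
    Measurable fun z => ‖translated U S φ z‖ ^ 2 := by
  have := countable_basisIndex U
  have h : Measurable fun z => ‖translated U S φ z‖ₑ ^ 2 := by
    simp_rw [enorm_sq_translated (intertwines_id U)]
    exact Measurable.tsum fun n => (measurable_enorm_inner_weyl₀_scaled 1 _ _).pow_const 2
  simpa using h.ennreal_toReal

theorem measurable_norm_translated (U : L2R ≃ₗᵢ[ℂ] H) (S : H →L[ℂ] H) (φ : H) :
    Measurable fun z => ‖translated U S φ z‖ := by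
  simpa using (measurable_norm_sq_translated U S φ).sqrt

theorem measurable_enorm_translated (U : L2R ≃ₗᵢ[ℂ] H) (S : H →L[ℂ] H) (φ : H) :
    Measurable fun z => ‖translated U S φ z‖ₑ := by
  simp_rw [← ofReal_norm]
  exact (measurable_norm_translated U S φ).ennreal_ofReal

/-- Polarization reduces this to norms, whose measurability comes from the basis expansion. -/
theorem measurable_inner_translated (U : L2R ≃ₗᵢ[ℂ] H) (S : H →L[ℂ] H) (ψ φ : H) :
    Measurable fun z => ⟪translated U S ψ z, translated U S φ z⟫_ℂ := by
  simp_rw [inner_eq_sum_norm_sq_div_four (𝕜 := ℂ), ← translated_smul, ← translated_add,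
    ← translated_sub]
  have h := measurable_norm_translated U S
  have h1 := h (ψ + φ)
  have h2 := h (ψ - φ)
  have h3 := h (ψ - (RCLike.I : ℂ) • φ)
  have h4 := h (ψ + (RCLike.I : ℂ) • φ)
  have hc := Complex.measurable_ofReal
  exact ((((hc.comp h1).pow_const 2).sub ((hc.comp h2).pow_const 2)).add
    ((((hc.comp h3).pow_const 2).sub ((hc.comp h4).pow_const 2)).mul_const _)).div_const _

/-- The distribution of the first coordinate under the density `‖S W(-q,p)* φ‖²` on phase space. -/
theorem lintegral_mul_enorm_sq_translated (hW : Intertwines U V c R) (hc : 0 < c)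
    (hR : MeasurePreserving R volume volume) (S : H →L[ℂ] H) (φ : H)
    {u : ℝ → ℝ≥0∞} (hu : Measurable u) :
    ∫⁻ z, u (R z).1 * ‖translated U S φ z‖ₑ ^ 2 = ENNReal.ofReal (2 * Real.pi) *
      ∫⁻ t, ∫⁻ s, u (c * (t - s)) ∂(rangeMeasure V (ContinuousLinearMap.adjoint S))
        ∂(densityMeasure (V.symm φ)) := by
  have := countable_basisIndex U
  set h : basisIndex H → L2R := fun n => V.symm (ContinuousLinearMap.adjoint S (onb H n)) with hh
  have hm := fun n => measurable_enorm_inner_weyl₀_scaled c (h n) (V.symm φ)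
  have hmh := fun n => (Lp.stronglyMeasurable (h n)).measurable
  have hmφ := (Lp.stronglyMeasurable (V.symm φ)).measurable
  simp_rw [enorm_sq_translated hW]
  have hF : Measurable fun z : ℝ × ℝ => u z.1 *
      ∑' n, ‖⟪weyl₀ (-z.1 / c) (c * z.2) (h n), V.symm φ⟫_ℂ‖ₑ ^ 2 :=
    (hu.comp measurable_fst).mul (Measurable.tsum fun n => (hm n).pow_const 2)
  rw [hR.lintegral_comp (f := fun z : ℝ × ℝ => u z.1 *
      ∑' n, ‖⟪weyl₀ (-z.1 / c) (c * z.2) (h n), V.symm φ⟫_ℂ‖ₑ ^ 2) hF]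
  simp_rw [← ENNReal.tsum_mul_left]
  rw [lintegral_tsum (f := fun n (z : ℝ × ℝ) => u z.1 *
    ‖⟪weyl₀ (-z.1 / c) (c * z.2) (h n), V.symm φ⟫_ℂ‖ₑ ^ 2) fun n =>
    ((hu.comp measurable_fst).mul ((hm n).pow_const 2)).aemeasurable]
  simp_rw [lintegral_mul_enorm_inner_weyl₀_sq _ _ hc hu]
  rw [ENNReal.tsum_mul_left]
  congr 1
  have e : ∀ t, ∫⁻ s, u (c * (t - s)) ∂(rangeMeasure V (ContinuousLinearMap.adjoint S)) =
      ∑' n, ∫⁻ s, u (c * (t - s)) * ‖h n s‖ₑ ^ 2 := fun t => by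
    rw [rangeMeasure, lintegral_sum_measure]
    exact tsum_congr fun n => lintegral_densityMeasure _ (by fun_prop)
  simp_rw [e]
  have hm2 : ∀ n, Measurable fun t => ∫⁻ s, u (c * (t - s)) * ‖h n s‖ₑ ^ 2 := fun n =>
    Measurable.lintegral_prod_right' (f := fun p : ℝ × ℝ => u (c * (p.1 - p.2)) * ‖h n p.2‖ₑ ^ 2)
      (by have := hmh n; fun_prop)
  rw [lintegral_densityMeasure _ (Measurable.tsum hm2)]
  simp_rw [← ENNReal.tsum_mul_right]
  have hφ2 : Measurable fun t => ‖V.symm φ t‖ₑ ^ 2 := by fun_prop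
  rw [lintegral_tsum (f := fun n t => (∫⁻ s, u (c * (t - s)) * ‖h n s‖ₑ ^ 2) *
    ‖V.symm φ t‖ₑ ^ 2) fun n => ((hm2 n).mul hφ2).aemeasurable]
  refine tsum_congr fun n => lintegral_congr fun t => ?_
  have := hmh n
  rw [← lintegral_mul_const _ (by fun_prop)]
  simp_rw [mul_assoc]

/-- The weight `u = 1` in the marginal formula: the total mass is `2π` times the squared
Hilbert–Schmidt norm of `S` times `‖φ‖²`. -/
theorem lintegral_enorm_sq_translated (U : L2R ≃ₗᵢ[ℂ] H) (S : H →L[ℂ] H) (φ : H) :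
    ∫⁻ z, ‖translated U S φ z‖ₑ ^ 2 =
      ENNReal.ofReal (2 * Real.pi) * ((∑' n, ‖S (onb H n)‖ₑ ^ 2) * ‖φ‖ₑ ^ 2) := by
  have := lintegral_mul_enorm_sq_translated (intertwines_id U) one_pos (MeasurePreserving.id _) S φ
    (u := fun _ => 1) measurable_const
  simp only [one_mul, lintegral_const, rangeMeasure_univ] at this
  rw [this, tsum_enorm_sq_adjoint, densityMeasure, withDensity_apply _ MeasurableSet.univ,
    Measure.restrict_univ, ← enorm_sq_eq_lintegral]

theorem memLp_norm_translated (U : L2R ≃ₗᵢ[ℂ] H) {S : H →L[ℂ] H}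
    (hS : Summable fun n => ‖S (onb H n)‖ ^ 2) (φ : H) :
    MemLp (fun z => ‖translated U S φ z‖) 2 volume := by
  refine ⟨(measurable_norm_translated U S φ).aestronglyMeasurable, ?_⟩
  have := eLpNorm_nnreal_pow_eq_lintegral (f := fun z => ‖translated U S φ z‖)
    (μ := (volume : Measure (ℝ × ℝ))) (p := 2) two_ne_zero
  simp only [ENNReal.coe_ofNat, NNReal.coe_ofNat, ENNReal.rpow_ofNat, enorm_norm,
    lintegral_enorm_sq_translated] at this
  rw [← ENNReal.pow_lt_top_iff.trans (or_iff_left two_ne_zero), this]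
  have := (summable_norm_sq_iff _).1 hS
  exact ENNReal.mul_lt_top ENNReal.ofReal_lt_top (ENNReal.mul_lt_top this.lt_top (by finiteness))

theorem integrable_inner_translated (U : L2R ≃ₗᵢ[ℂ] H) {S : H →L[ℂ] H}
    (hS : Summable fun n => ‖S (onb H n)‖ ^ 2) (ψ φ : H) :
    Integrable fun z => ⟪translated U S ψ z, translated U S φ z⟫_ℂ := by
  refine Integrable.mono' ((memLp_norm_translated U hS ψ).integrable_mul
    (memLp_norm_translated U hS φ)) (measurable_inner_translated U S ψ φ).aestronglyMeasurable
    (Eventually.of_forall fun z => norm_inner_le_norm _ _)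

theorem integral_norm_sq_translated (U : L2R ≃ₗᵢ[ℂ] H) (S : H →L[ℂ] H) (φ : H) :
    ∫ z, ‖translated U S φ z‖ ^ 2 = 2 * Real.pi * (∑' n, ‖S (onb H n)‖ ^ 2) * ‖φ‖ ^ 2 := by
  rw [integral_eq_lintegral_of_nonneg_ae (Eventually.of_forall fun z => by positivity)
    (measurable_norm_sq_translated U S φ).aestronglyMeasurable]
  simp_rw [ENNReal.ofReal_pow (norm_nonneg _), ofReal_norm]
  rw [lintegral_enorm_sq_translated, ENNReal.toReal_mul, ENNReal.toReal_mul,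
    ENNReal.toReal_ofReal (by positivity), ENNReal.toReal_pow, toReal_enorm,
    ENNReal.tsum_toReal_eq fun n => by finiteness]
  simp only [ENNReal.toReal_pow, toReal_enorm]
  ring

theorem norm_setIntegral_inner_translated_le (U : L2R ≃ₗᵢ[ℂ] H) {S : H →L[ℂ] H}
    (hS : Summable fun n => ‖S (onb H n)‖ ^ 2) (B : Set (ℝ × ℝ)) (ψ φ : H) :
    ‖∫ z in B, ⟪translated U S ψ z, translated U S φ z⟫_ℂ‖ ≤
      2 * Real.pi * (∑' n, ‖S (onb H n)‖ ^ 2) * ‖ψ‖ * ‖φ‖ := by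
  have h2 := memLp_norm_translated U hS
  have hint := (h2 ψ).integrable_mul (h2 φ)
  have h0 : 0 ≤ ∑' n, ‖S (onb H n)‖ ^ 2 := tsum_nonneg fun n => by positivity
  calc ‖∫ z in B, ⟪translated U S ψ z, translated U S φ z⟫_ℂ‖
      ≤ ∫ z in B, ‖translated U S ψ z‖ * ‖translated U S φ z‖ :=
        norm_integral_le_of_norm_le hint.integrableOn
          (Eventually.of_forall fun z => norm_inner_le_norm _ _)
    _ ≤ ∫ z, ‖translated U S ψ z‖ * ‖translated U S φ z‖ :=
        setIntegral_le_integral hint (Eventually.of_forall fun z => by positivity)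
    _ ≤ (∫ z, ‖translated U S ψ z‖ ^ (2 : ℝ)) ^ (1 / 2 : ℝ) *
          (∫ z, ‖translated U S φ z‖ ^ (2 : ℝ)) ^ (1 / 2 : ℝ) :=
        integral_mul_le_Lp_mul_Lq_of_nonneg Real.HolderConjugate.two_two
          (Eventually.of_forall fun z => norm_nonneg _) (Eventually.of_forall fun z => norm_nonneg _)
          (by simpa using h2 ψ) (by simpa using h2 φ)
    _ = _ := by
        simp only [Real.rpow_two, integral_norm_sq_translated, ← Real.sqrt_eq_rpow]
        rw [← Real.sqrt_mul (by positivity)]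
        rw [show 2 * Real.pi * (∑' n, ‖S (onb H n)‖ ^ 2) * ‖ψ‖ ^ 2 *
          (2 * Real.pi * (∑' n, ‖S (onb H n)‖ ^ 2) * ‖φ‖ ^ 2) =
          (2 * Real.pi * (∑' n, ‖S (onb H n)‖ ^ 2) * ‖ψ‖ * ‖φ‖) ^ 2 by ring]
        exact Real.sqrt_sq (by positivity)

end PhaseSpaceDensity

/-! ### The covariant observable and its scalar integrals. -/

section Observable

variable {H : Type*} [NormedAddCommGroup H] [InnerProductSpace ℂ H] [CompleteSpace H]

theorem inner_beta (U : L2R ≃ₗᵢ[ℂ] H) {S T : H →L[ℂ] H}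
    (hT : T = ContinuousLinearMap.adjoint S ∘L S) (z : ℝ × ℝ) (ψ φ : H) :
    ⟪ψ, beta U z T φ⟫_ℂ = ⟪translated U S ψ z, translated U S φ z⟫_ℂ := by
  subst hT
  simp only [beta, translated, ContinuousLinearMap.comp_apply]
  rw [← ContinuousLinearMap.adjoint_inner_left, ContinuousLinearMap.adjoint_inner_right]

/-- The bounded operator representing the weak integral over `B`. -/
theorem exists_weak_setIntegral (U : L2R ≃ₗᵢ[ℂ] H) {S : H →L[ℂ] H}
    (hS : Summable fun n => ‖S (onb H n)‖ ^ 2) (B : Set (ℝ × ℝ)) :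
    ∃ A : H →L[ℂ] H, ∀ ψ φ, ⟪ψ, A φ⟫_ℂ =
      (2 * (Real.pi : ℂ))⁻¹ * ∫ z in B, ⟪translated U S ψ z, translated U S φ z⟫_ℂ := by
  have hint := fun ψ φ => (integrable_inner_translated U hS ψ φ).integrableOn (s := B)
  let F : H →ₗ⋆[ℂ] H →ₗ[ℂ] ℂ := LinearMap.mk₂'ₛₗ (starRingEnd ℂ) (RingHom.id ℂ)
    (fun ψ φ => (2 * (Real.pi : ℂ))⁻¹ * ∫ z in B, ⟪translated U S ψ z, translated U S φ z⟫_ℂ)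
    (fun ψ ψ' φ => by
      simp only [translated_add, inner_add_left]
      rw [integral_add (hint _ _) (hint _ _), mul_add])
    (fun a ψ φ => by
      simp only [translated_smul, inner_smul_left]
      rw [integral_const_mul, smul_eq_mul]
      ring)
    (fun ψ φ φ' => by
      simp only [translated_add, inner_add_right]
      rw [integral_add (hint _ _) (hint _ _), mul_add])
    (fun a ψ φ => by
      simp only [translated_smul, inner_smul_right]
      rw [integral_const_mul, smul_eq_mul, RingHom.id_apply]
      ring)
  have hF : ∀ ψ φ, F ψ φ =
      (2 * (Real.pi : ℂ))⁻¹ * ∫ z in B, ⟪translated U S ψ z, translated U S φ z⟫_ℂ :=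
    fun ψ φ => rfl
  let G : H →L⋆[ℂ] H →L[ℂ] ℂ := F.mkContinuous₂
    (‖(2 * (Real.pi : ℂ))⁻¹‖ * (2 * Real.pi * (∑' n, ‖S (onb H n)‖ ^ 2))) fun ψ φ => by
      rw [hF, norm_mul]
      have := mul_le_mul_of_nonneg_left (norm_setIntegral_inner_translated_le U hS B ψ φ)
        (norm_nonneg (2 * (Real.pi : ℂ))⁻¹)
      refine this.trans_eq (by ring)
  -- The operator representing the form acts in the first slot of the inner product; its adjoint
  -- acts in the second.
  refine ⟨ContinuousLinearMap.adjoint (InnerProductSpace.continuousLinearMapOfBilin G),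
    fun ψ φ => ?_⟩
  rw [ContinuousLinearMap.adjoint_inner_right, InnerProductSpace.continuousLinearMapOfBilin_apply]
  rfl

/-- Positivity comes from the density `‖S W* φ‖²`, σ-additivity from integrability of the
off-diagonal densities. Existence rules out the default branch in `covariantObservable`. -/
theorem exists_isGeneratedBy (U : L2R ≃ₗᵢ[ℂ] H) {S T : H →L[ℂ] H}
    (hT : T = ContinuousLinearMap.adjoint S ∘L S) (hS : Summable fun n => ‖S (onb H n)‖ ^ 2) :
    ∃ E, IsGeneratedBy U T E := by
  classical
  choose A hA using exists_weak_setIntegral U hS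
  have hint := fun ψ φ => integrable_inner_translated U hS ψ φ
  have hpos : ∀ B, (A B).IsPositive := fun B => by
    rw [ContinuousLinearMap.isPositive_iff_complex]
    intro φ
    have h1 : ⟪φ, A B φ⟫_ℂ = (((2 * Real.pi)⁻¹ * ∫ z in B, ‖translated U S φ z‖ ^ 2 : ℝ) : ℂ) := by
      rw [hA]
      simp only [inner_self_eq_norm_sq_to_K]
      push_cast
      rw [← integral_complex_ofReal]
      simp
    have h2 : ⟪A B φ, φ⟫_ℂ = (((2 * Real.pi)⁻¹ * ∫ z in B, ‖translated U S φ z‖ ^ 2 : ℝ) : ℂ) := by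
      rw [← inner_conj_symm, h1, Complex.conj_ofReal]
    rw [h2]
    refine ⟨by simp, ?_⟩
    rw [RCLike.re_to_complex, Complex.ofReal_re]
    exact mul_nonneg (by positivity) (integral_nonneg fun z => by positivity)
  let E : PositiveOperatorMeasure (ℝ × ℝ) H :=
    { toFun := fun B => if MeasurableSet B then A B else 0
      isPositive := fun B => by
        split_ifs
        · exact hpos B
        · exact ContinuousLinearMap.isPositive_zero
      not_measurable := fun B hB => if_neg hB
      empty := by
        rw [if_pos MeasurableSet.empty]
        ext φ
        refine ext_inner_left ℂ fun ψ => ?_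
        rw [hA]
        simp
      hasSum_inner := fun B hB hd ψ φ => by
        simp only [hB, MeasurableSet.iUnion hB, if_true, hA]
        exact (hasSum_integral_iUnion hB hd (hint ψ φ).integrableOn).mul_left _ }
  refine ⟨E, fun B hB ψ φ => ?_⟩
  simp only [inner_beta U hT]
  refine ⟨(hint ψ φ).integrableOn, ?_⟩
  change ⟪ψ, (if MeasurableSet B then A B else 0) φ⟫_ℂ = _
  rw [if_pos hB, hA]

theorem isGeneratedBy_covariantObservable (U : L2R ≃ₗᵢ[ℂ] H) {S T : H →L[ℂ] H}
    (hT : T = ContinuousLinearMap.adjoint S ∘L S) (hS : Summable fun n => ‖S (onb H n)‖ ^ 2) :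
    IsGeneratedBy U T (covariantObservable U T) := by
  have h := exists_isGeneratedBy U hT hS
  rw [covariantObservable, dif_pos h]
  exact h.choose_spec

variable {U : L2R ≃ₗᵢ[ℂ] H} {S T : H →L[ℂ] H} {E : PositiveOperatorMeasure (ℝ × ℝ) H}

/-- An upper bound is enough: it yields integrability, hence membership in the domain of the
operator integral. The reverse domain inclusion will come from symmetry. -/
theorem variation_scalar_le (hE : IsGeneratedBy U T E)
    (hT : T = ContinuousLinearMap.adjoint S ∘L S) (ψ φ : H) :
    (E.scalar ψ φ).variation ≤ volume.withDensity fun z =>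
      ‖(2 * (Real.pi : ℂ))⁻¹‖ₑ * ‖⟪translated U S ψ z, translated U S φ z⟫_ℂ‖ₑ := by
  refine VectorMeasure.variation_le_of_forall_enorm_le fun B hB => ?_
  rw [withDensity_apply _ hB, PositiveOperatorMeasure.scalar_apply, (hE B hB ψ φ).2, enorm_mul,
    lintegral_const_mul _ (measurable_inner_translated U S ψ φ).enorm]
  simp only [inner_beta U hT]
  gcongr
  exact enorm_integral_le_lintegral_enorm _

theorem integrable_scalar (hE : IsGeneratedBy U T E)
    (hT : T = ContinuousLinearMap.adjoint S ∘L S) {f : ℝ × ℝ → ℂ} (hf : Measurable f) {ψ φ : H}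
    (h : Integrable fun z => f z * ⟪translated U S ψ z, translated U S φ z⟫_ℂ) :
    (E.scalar ψ φ).Integrable f := by
  refine Integrable.mono_measure ?_ (variation_scalar_le hE hT ψ φ)
  refine ⟨hf.aestronglyMeasurable, ?_⟩
  have hm := measurable_inner_translated U S ψ φ
  rw [HasFiniteIntegral, lintegral_withDensity_eq_lintegral_mul _ (by fun_prop) hf.enorm]
  have := (h.const_mul (2 * (Real.pi : ℂ))⁻¹).2
  rw [HasFiniteIntegral] at this
  refine lt_of_le_of_lt (lintegral_mono fun z => le_of_eq ?_) this
  simp only [Pi.mul_apply, enorm_mul]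
  ring

/-- The diagonal integrals are integrals against the density `(2π)⁻¹ ‖S W(-q,p)* φ‖²`. -/
theorem integral_scalar_self (hE : IsGeneratedBy U T E)
    (hT : T = ContinuousLinearMap.adjoint S ∘L S) (hS : Summable fun n => ‖S (onb H n)‖ ^ 2)
    {f : ℝ × ℝ → ℂ} (hf : Measurable f) {φ : H}
    (h : Integrable fun z => f z * ⟪translated U S φ z, translated U S φ z⟫_ℂ) :
    E.integral f φ φ = (2 * (Real.pi : ℂ))⁻¹ *
      ∫ z, f z ∂(volume.withDensity fun z => ‖translated U S φ z‖ₑ ^ 2) := by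
  set ν := volume.withDensity fun z => ‖translated U S φ z‖ₑ ^ 2 with hν
  have hm := measurable_enorm_translated U S φ
  have hfin : IsFiniteMeasure ν := by
    refine ⟨?_⟩
    rw [hν, withDensity_apply _ MeasurableSet.univ, Measure.restrict_univ,
      lintegral_enorm_sq_translated]
    have := (summable_norm_sq_iff _).1 hS
    exact ENNReal.mul_lt_top ENNReal.ofReal_lt_top (ENNReal.mul_lt_top this.lt_top (by finiteness))
  have hval : ∀ B, MeasurableSet B → E.scalar φ φ B = (2 * (Real.pi : ℂ))⁻¹ * (ν.real B : ℂ) := by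
    intro B hB
    rw [PositiveOperatorMeasure.scalar_apply, (hE B hB φ φ).2]
    simp only [inner_beta U hT, inner_self_eq_norm_sq_to_K]
    congr 1
    have e : ∫ z in B, ‖translated U S φ z‖ ^ 2 = ν.real B := by
      rw [integral_eq_lintegral_of_nonneg_ae (Eventually.of_forall fun z => by positivity)
        (measurable_norm_sq_translated U S φ).aestronglyMeasurable, measureReal_def, hν,
        withDensity_apply _ hB]
      simp_rw [ENNReal.ofReal_pow (norm_nonneg _), ofReal_norm]
    rw [← e, ← integral_complex_ofReal]
    simp
  have hfν : Integrable f ν := by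
    refine ⟨hf.aestronglyMeasurable, ?_⟩
    rw [HasFiniteIntegral, hν, lintegral_withDensity_eq_lintegral_mul _ (by fun_prop) hf.enorm]
    refine lt_of_le_of_lt (lintegral_mono fun z => le_of_eq ?_) h.2
    simp only [Pi.mul_apply, enorm_mul, inner_self_eq_norm_sq_to_K, enorm_pow]
    have : ‖((‖translated U S φ z‖ : ℝ) : ℂ)‖ₑ = ‖translated U S φ z‖ₑ := by
      rw [← ofReal_norm, Complex.norm_real, norm_norm, ofReal_norm]
    rw [mul_comm]
    congr 2
    exact this.symm
  -- Both integrals are limits over the same simple functions, for which they agree term by term by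
  -- `hval`.
  have l1 := PositiveOperatorMeasure.integral_eq_lim hf (integrable_scalar hE hT hf h)
  refine tendsto_nhds_unique l1 ?_
  have l2 := (tendsto_integral_approxOn_of_measurable_of_range_subset hf hfν
    (Set.range f ∪ {0}) (by rfl)).const_mul (2 * (Real.pi : ℂ))⁻¹
  refine l2.congr fun n => ?_
  have hi : Integrable (SimpleFunc.approxOn f hf (Set.range f ∪ {0}) 0 (by simp) n) ν :=
    SimpleFunc.integrable_approxOn_range hf hfν n
  rw [SimpleFunc.integral_eq_integral _ hi, SimpleFunc.integral_eq_sum _ hi, Finset.mul_sum]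
  refine Finset.sum_congr rfl fun a _ => ?_
  rw [hval _ (SimpleFunc.measurableSet_preimage _ _), Complex.real_smul]
  ring

/-- The operator integral of a real function is symmetric. -/
theorem inner_operatorIntegral_symm {f : ℝ × ℝ → ℂ} (hf : Measurable f)
    (hreal : ∀ z, (starRingEnd ℂ) (f z) = f z) (ψ φ : (E.operatorIntegral hf).domain) :
    ⟪(ψ : H), E.operatorIntegral hf φ⟫_ℂ = ⟪E.operatorIntegral hf ψ, (φ : H)⟫_ℂ := by
  have hself : ∀ B, (starRingEnd ℂ) (E.scalar φ ψ B) = E.scalar ψ φ B := fun B => by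
    rw [PositiveOperatorMeasure.scalar_apply, PositiveOperatorMeasure.scalar_apply, inner_conj_symm]
    exact (E.isPositive B).isSymmetric _ _
  rw [← inner_conj_symm (E.operatorIntegral hf ψ), PositiveOperatorMeasure.inner_operatorIntegral,
    PositiveOperatorMeasure.inner_operatorIntegral]
  refine tendsto_nhds_unique (PositiveOperatorMeasure.integral_eq_lim hf (φ.2 ψ)) ?_
  refine ((Complex.continuous_conj.tendsto _).comp
    (PositiveOperatorMeasure.integral_eq_lim hf (ψ.2 φ))).congr fun n => ?_
  rw [Function.comp_apply, map_sum]
  refine Finset.sum_congr rfl fun a ha => ?_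
  rw [map_mul, hself]
  congr 1
  -- The approximating simple functions take values in `range f ∪ {0}`, so their values are real as
  -- well.
  obtain ⟨z, rfl⟩ := SimpleFunc.mem_range.1 ha
  rcases SimpleFunc.approxOn_mem hf (s := Set.range f ∪ {0}) (y₀ := 0) (by simp) n z with ⟨w, hw⟩ | h0
  · rw [← hw, hreal]
  · rw [Set.mem_singleton_iff] at h0
    rw [h0, map_zero]

end Observable

/-! ### Moments of the two measures, and traces. -/

section Moments

variable {H : Type*} [NormedAddCommGroup H] [InnerProductSpace ℂ H]

theorem lintegral_pow_densityMeasure (V : L2R ≃ₗᵢ[ℂ] H) {c : ℝ} (hc : c ≠ 0) {k : ℕ}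
    (φ : (powOp (scaledPosition V c) k).domain) :
    ∫⁻ t, (‖c * t‖ₑ ^ k) ^ 2 ∂(densityMeasure (V.symm (φ : H))) =
      ‖powOp (scaledPosition V c) k φ‖ₑ ^ 2 := by
  rw [lintegral_densityMeasure _ (by fun_prop), enorm_sq_eq_lintegral V]
  refine lintegral_congr_ae ?_
  filter_upwards [coeFn_powOp_scaledPosition V hc φ] with t ht
  rw [ht, enorm_mul _ (V.symm (φ : H) t), mul_pow _ (‖V.symm (φ : H) t‖ₑ), enorm_pow]
  congr 3
  rw [← ofReal_norm, ← ofReal_norm, Complex.norm_real]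

theorem integral_pow_densityMeasure (V : L2R ≃ₗᵢ[ℂ] H) {c : ℝ} (hc : c ≠ 0) {k : ℕ}
    (φ : (powOp (scaledPosition V c) k).domain) :
    ∫ t, ((c * t : ℝ) : ℂ) ^ k ∂(densityMeasure (V.symm (φ : H))) =
      ⟪(φ : H), powOp (scaledPosition V c) k φ⟫_ℂ := by
  have hm := (Lp.stronglyMeasurable (V.symm (φ : H))).measurable
  rw [densityMeasure, integral_withDensity_eq_integral_toReal_smul (by fun_prop)
    (Eventually.of_forall fun t => by finiteness), ← V.symm.inner_map_map, L2.inner_def]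
  refine integral_congr_ae ?_
  filter_upwards [coeFn_powOp_scaledPosition V hc φ] with t ht
  rw [ht, RCLike.inner_apply, mul_assoc, RCLike.mul_conj]
  simp only [ENNReal.toReal_pow, toReal_enorm, Complex.real_smul]
  rw [Complex.ofReal_pow]
  exact mul_comm _ _

/-- Domination by `|x|ʲ ≤ 1 + |x|²ᵏ`; the constant is integrable because the measure is finite. -/
theorem integrable_pow_of_lintegral {μ : Measure ℝ} [IsFiniteMeasure μ] {c : ℝ} {j k : ℕ}
    (hjk : j ≤ k) (h : ∫⁻ t, (‖c * t‖ₑ ^ k) ^ 2 ∂μ ≠ ∞) :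
    Integrable (fun t : ℝ => ((c * t : ℝ) : ℂ) ^ j) μ := by
  have h1 : Integrable (fun t : ℝ => (((c * t : ℝ) : ℂ) ^ k) ^ 2) μ := by
    refine ⟨(by fun_prop : Continuous fun t : ℝ => (((c * t : ℝ) : ℂ) ^ k) ^ 2).aestronglyMeasurable,
      lt_of_le_of_lt (lintegral_mono fun t => le_of_eq ?_) h.lt_top⟩
    rw [enorm_pow, enorm_pow, ← ofReal_norm, ← ofReal_norm, Complex.norm_real]
  refine ((integrable_const (1 : ℝ)).add h1.norm).mono'
    (by fun_prop : Continuous fun t : ℝ => ((c * t : ℝ) : ℂ) ^ j).aestronglyMeasurable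
    (Eventually.of_forall fun t => ?_)
  rw [Pi.add_apply, norm_pow, norm_pow, norm_pow, Complex.norm_real]
  rcases le_total ‖c * t‖ 1 with h | h
  · have := pow_le_one₀ (n := j) (norm_nonneg _) h
    have := sq_nonneg (‖c * t‖ ^ k)
    linarith
  · have h2 := pow_le_pow_right₀ h hjk
    have h3 : 1 ≤ ‖c * t‖ ^ k := one_le_pow₀ h
    nlinarith

theorem prodOp_comp_ofBounded {A : H →ₗ.[ℂ] H} {S C X : H →L[ℂ] H}
    (h : prodOp A (ofBounded S) = ofBounded C) :
    prodOp A (ofBounded (S ∘L X)) = ofBounded (C ∘L X) := by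
  have hd : ∀ x, S x ∈ A.domain := fun x => by
    have : x ∈ (ofBounded C).domain := trivial
    rw [← h] at this
    exact this.2
  refine LinearPMap.ext (by ext x; exact ⟨fun _ => trivial, fun _ => ⟨trivial, hd (X x)⟩⟩)
    fun x h1 h2 => ?_
  exact (LinearPMap.ext_iff.1 h).2 (x := X x) (hf := ⟨trivial, hd (X x)⟩) (hg := trivial)

variable [CompleteSpace H]

theorem lintegral_pow_rangeMeasure (V : L2R ≃ₗᵢ[ℂ] H) {c : ℝ} (hc : c ≠ 0) {k : ℕ}
    {S B : H →L[ℂ] H} (h : prodOp (powOp (scaledPosition V c) k) (ofBounded S) = ofBounded B) :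
    ∫⁻ s, (‖c * s‖ₑ ^ k) ^ 2 ∂(rangeMeasure V S) = ∑' n, ‖B (onb H n)‖ₑ ^ 2 := by
  rw [rangeMeasure, lintegral_sum_measure]
  refine tsum_congr fun n => ?_
  have hd : S (onb H n) ∈ (powOp (scaledPosition V c) k).domain := by
    have : (onb H n : H) ∈ (ofBounded B).domain := trivial
    rw [← h] at this
    exact this.2
  rw [lintegral_pow_densityMeasure V hc ⟨_, hd⟩]
  congr 2
  exact (LinearPMap.ext_iff.1 h).2 (x := onb H n) (hf := ⟨trivial, hd⟩) (hg := trivial)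

theorem trace_ofBounded (X : H →L[ℂ] H) :
    trace (ofBounded X) = ∑' n, ⟪(onb H n : H), X (onb H n)⟫_ℂ := by
  rw [trace]
  refine tsum_congr fun n => ?_
  rw [dif_pos (show (onb H n : H) ∈ (ofBounded X).domain from trivial)]
  rfl

theorem isFiniteMeasure_rangeMeasure (V : L2R ≃ₗᵢ[ℂ] H) {S : H →L[ℂ] H}
    (hS : Summable fun n => ‖S (onb H n)‖ ^ 2) : IsFiniteMeasure (rangeMeasure V S) :=
  ⟨by rw [rangeMeasure_univ]; exact ((summable_norm_sq_iff _).1 hS).lt_top⟩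

variable {V : L2R ≃ₗᵢ[ℂ] H} {c : ℝ} {k : ℕ} {S B : H →L[ℂ] H}

theorem summable_of_norm_sq_le {C : H →L[ℂ] H} (hS : Summable fun n => ‖S (onb H n)‖ ^ 2)
    (hB : Summable fun n => ‖B (onb H n)‖ ^ 2) (hC : ∀ x, ‖C x‖ ^ 2 ≤ ‖S x‖ ^ 2 + ‖B x‖ ^ 2) :
    Summable fun n => ‖C (onb H n)‖ ^ 2 :=
  Summable.of_nonneg_of_le (fun n => by positivity) (fun n => hC _) (hS.add hB)

/-- With `C = Aʲ S`, cyclicity of the trace in the form `tsum_inner_adjoint` gives `Tr[C S] = ∑ ⟪S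
eₙ, C eₙ⟫`. Each term is the `j`-th moment of the density of `S eₙ`. -/
theorem integral_pow_rangeMeasure (hc : c ≠ 0)
    (h : prodOp (powOp (scaledPosition V c) k) (ofBounded S) = ofBounded B)
    (hS : Summable fun n => ‖S (onb H n)‖ ^ 2) (hB : Summable fun n => ‖B (onb H n)‖ ^ 2)
    (hSS : ContinuousLinearMap.adjoint S = S) {j : ℕ} (hjk : j ≤ k) :
    ∫ s, ((c * s : ℝ) : ℂ) ^ j ∂(rangeMeasure V S) =
      trace (prodOp (powOp (scaledPosition V c) j) (ofBounded (S ∘L S))) := by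
  have := isFiniteMeasure_rangeMeasure V hS
  obtain ⟨C, hC, hCle⟩ := powOp_prod_ofBounded_eq V hc hjk h
  have hint : Integrable (fun s : ℝ => ((c * s : ℝ) : ℂ) ^ j) (rangeMeasure V S) :=
    integrable_pow_of_lintegral hjk (by
      rw [lintegral_pow_rangeMeasure V hc h]
      exact (summable_norm_sq_iff _).1 hB)
  have hCs := summable_of_norm_sq_le hS hB hCle
  rw [prodOp_comp_ofBounded hC, trace_ofBounded]
  have e : ∀ n, ⟪(onb H n : H), (C ∘L S) (onb H n)⟫_ℂ =
      ⟪(ContinuousLinearMap.adjoint C) (onb H n), S (onb H n)⟫_ℂ := fun n => by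
    rw [ContinuousLinearMap.adjoint_inner_left]
    rfl
  rw [tsum_congr e, tsum_inner_adjoint (onb H) (summable_norm_sq_adjoint _ hCs) hS, hSS,
    ContinuousLinearMap.adjoint_adjoint, rangeMeasure, integral_sum_measure hint]
  refine tsum_congr fun n => ?_
  have hd : S (onb H n) ∈ (powOp (scaledPosition V c) j).domain := by
    have : (onb H n : H) ∈ (ofBounded C).domain := trivial
    rw [← hC] at this
    exact this.2
  rw [integral_pow_densityMeasure V hc ⟨_, hd⟩]
  congr 1
  exact (LinearPMap.ext_iff.1 hC).2 (x := onb H n) (hf := ⟨trivial, hd⟩) (hg := trivial)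

/-- `Aʲ S²` is the product of the Hilbert–Schmidt operators `Aʲ S` and `S`. -/
theorem isTraceClass_powOp_prod (hc : c ≠ 0)
    (h : prodOp (powOp (scaledPosition V c) k) (ofBounded S) = ofBounded B)
    (hS : Summable fun n => ‖S (onb H n)‖ ^ 2) (hB : Summable fun n => ‖B (onb H n)‖ ^ 2)
    {j : ℕ} (hjk : j ≤ k) :
    IsTraceClass (prodOp (powOp (scaledPosition V c) j) (ofBounded (S ∘L S))) := by
  obtain ⟨C, hC, hCle⟩ := powOp_prod_ofBounded_eq V hc hjk h
  exact ⟨C ∘L S, prodOp_comp_ofBounded hC,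
    summable_inner_cfcAbs_comp (onb H) (summable_of_norm_sq_le hS hB hCle) hS⟩

theorem add_pow_sq_le (a b : ℝ≥0∞) (k : ℕ) :
    ((a + b) ^ k) ^ 2 ≤ (2 ^ k) ^ 2 * ((a ^ k) ^ 2 + (b ^ k) ^ 2) := by
  have key : ∀ x y : ℝ≥0∞, x ≤ y → ((x + y) ^ k) ^ 2 ≤ (2 ^ k) ^ 2 * (y ^ k) ^ 2 := by
    intro x y hxy
    rw [← mul_pow, ← mul_pow, two_mul]
    gcongr
  rcases le_total a b with hab | hab
  · exact (key a b hab).trans (by gcongr; exact le_add_self)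
  · rw [add_comm a b]
    exact (key b a hab).trans (by gcongr; exact le_self_add)

theorem enorm_sub_pow_sq_le (c t s : ℝ) (k : ℕ) :
    (‖c * (t - s)‖ₑ ^ k) ^ 2 ≤
      (2 ^ k) ^ 2 * ((‖c * t‖ₑ ^ k) ^ 2 + (‖c * s‖ₑ ^ k) ^ 2) := by
  refine le_trans ?_ (add_pow_sq_le _ _ k)
  gcongr
  rw [mul_sub]
  exact enorm_sub_le

theorem lintegral_lintegral_pow_lt_top {μ ρ : Measure ℝ} [IsFiniteMeasure μ] [IsFiniteMeasure ρ]
    (hμ : ∫⁻ t, (‖c * t‖ₑ ^ k) ^ 2 ∂μ ≠ ∞) (hρ : ∫⁻ s, (‖c * s‖ₑ ^ k) ^ 2 ∂ρ ≠ ∞) :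
    ∫⁻ t, ∫⁻ s, (‖c * (t - s)‖ₑ ^ k) ^ 2 ∂ρ ∂μ < ∞ := by
  refine lt_of_le_of_lt (lintegral_mono fun t => lintegral_mono fun s =>
    enorm_sub_pow_sq_le c t s k) ?_
  have e : ∀ t, ∫⁻ s, (2 ^ k) ^ 2 * ((‖c * t‖ₑ ^ k) ^ 2 + (‖c * s‖ₑ ^ k) ^ 2) ∂ρ =
      (2 ^ k) ^ 2 * ((‖c * t‖ₑ ^ k) ^ 2 * ρ Set.univ + ∫⁻ s, (‖c * s‖ₑ ^ k) ^ 2 ∂ρ) := fun t => by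
    rw [lintegral_const_mul _ (by fun_prop), lintegral_add_left (by fun_prop), lintegral_const]
  simp_rw [e]
  rw [lintegral_const_mul _ (by fun_prop), lintegral_add_left (by fun_prop), lintegral_const,
    lintegral_mul_const _ (by fun_prop)]
  refine ENNReal.mul_lt_top (by finiteness) (ENNReal.add_lt_top.2 ⟨?_, ?_⟩)
  · exact ENNReal.mul_lt_top hμ.lt_top (measure_lt_top _ _)
  · exact ENNReal.mul_lt_top hρ.lt_top (measure_lt_top _ _)

/-- The binomial theorem and Fubini: this is where the coefficients of the moment polynomial arise.
-/
theorem integral_prod_sub_pow {μ ρ : Measure ℝ} [IsFiniteMeasure μ] [IsFiniteMeasure ρ]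
    (hμ : ∫⁻ t, (‖c * t‖ₑ ^ k) ^ 2 ∂μ ≠ ∞) (hρ : ∫⁻ s, (‖c * s‖ₑ ^ k) ^ 2 ∂ρ ≠ ∞) :
    ∫ p : ℝ × ℝ, ((c * (p.1 - p.2) : ℝ) : ℂ) ^ k ∂(μ.prod ρ) =
      ∑ l ∈ Finset.range (k + 1), (k.choose l : ℂ) * (-1) ^ (k - l) *
        (∫ s, ((c * s : ℝ) : ℂ) ^ (k - l) ∂ρ) * ∫ t, ((c * t : ℝ) : ℂ) ^ l ∂μ := by
  have e : ∀ p : ℝ × ℝ, ((c * (p.1 - p.2) : ℝ) : ℂ) ^ k =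
      ∑ l ∈ Finset.range (k + 1), ((k.choose l : ℂ) * (-1) ^ (k - l)) *
        (((c * p.1 : ℝ) : ℂ) ^ l * ((c * p.2 : ℝ) : ℂ) ^ (k - l)) := fun p => by
    rw [show ((c * (p.1 - p.2) : ℝ) : ℂ) = ((c * p.1 : ℝ) : ℂ) + -((c * p.2 : ℝ) : ℂ) by
      push_cast; ring, add_pow]
    refine Finset.sum_congr rfl fun l _ => ?_
    rw [neg_pow]
    ring
  simp_rw [e]
  rw [integral_finsetSum]
  · refine Finset.sum_congr rfl fun l _ => ?_
    rw [integral_const_mul, integral_prod_mul (fun t : ℝ => ((c * t : ℝ) : ℂ) ^ l)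
      (fun s : ℝ => ((c * s : ℝ) : ℂ) ^ (k - l))]
    ring
  · intro l hl
    have hl' : l ≤ k := Nat.lt_succ_iff.1 (Finset.mem_range.1 hl)
    exact ((integrable_pow_of_lintegral hl' hμ).mul_prod
      (integrable_pow_of_lintegral (Nat.sub_le k l) hρ)).const_mul _

end Moments

/-! ### Maximality of real multiplication operators among symmetric ones. -/

section SelfAdjoint

theorem memLp_indicator_Icc_mul {g f : ℝ → ℂ} (hg : Continuous g) (hf : MemLp f 2 volume) (N : ℕ) :
    MemLp ((Set.Icc (-N : ℝ) N).indicator fun t => g t * f t) 2 volume := by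
  obtain ⟨C, hC⟩ := (isCompact_Icc (a := (-N : ℝ)) (b := N)).exists_bound_of_continuousOn
    hg.continuousOn
  refine (hf.const_mul (C : ℂ)).of_le
    ((hg.aestronglyMeasurable.mul hf.1).indicator measurableSet_Icc) (Eventually.of_forall fun t => ?_)
  by_cases ht : t ∈ Set.Icc (-N : ℝ) N
  · rw [Set.indicator_of_mem ht, norm_mul, norm_mul, Complex.norm_real]
    exact mul_le_mul_of_nonneg_right ((hC t ht).trans (le_abs_self C)) (norm_nonneg _)
  · rw [Set.indicator_of_notMem ht, norm_zero]
    positivity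

theorem lintegral_le_of_forall_Icc {F : ℝ → ℝ≥0∞} (hF : AEMeasurable F volume) {K : ℝ≥0∞}
    (h : ∀ N : ℕ, ∫⁻ t in Set.Icc (-N : ℝ) N, F t ≤ K) : ∫⁻ t, F t ≤ K := by
  have hcov : AECover volume atTop fun N : ℕ => Set.Icc (-N : ℝ) N :=
    aecover_Icc (tendsto_neg_atTop_atBot.comp tendsto_natCast_atTop_atTop)
      tendsto_natCast_atTop_atTop
  exact le_of_tendsto (hcov.lintegral_tendsto_of_countably_generated hF) (Eventually.of_forall h)

variable {H : Type*} [NormedAddCommGroup H] [InnerProductSpace ℂ H]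

/-- Complex polarization, with the vectors `ψ + φ` and `ψ + iφ`. -/
theorem inner_eq_of_diagonal {D : Submodule ℂ H} (X : D →ₗ[ℂ] H)
    (h : ∀ φ : D, ⟪(φ : H), X φ⟫_ℂ = 0) (ψ φ : D) : ⟪(ψ : H), X φ⟫_ℂ = 0 := by
  have h1 := h (ψ + φ)
  have h2 := h (ψ + Complex.I • φ)
  simp only [map_add, map_smul, Submodule.coe_add, Submodule.coe_smul, inner_add_left,
    inner_add_right, inner_smul_left, inner_smul_right, h, zero_add, add_zero, mul_zero,
    Complex.conj_I] at h1 h2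
  have h3 : Complex.I * (⟪(ψ : H), X φ⟫_ℂ - ⟪(φ : H), X ψ⟫_ℂ) = 0 := by
    rw [← h2]
    ring
  have h4 := (mul_eq_zero.1 h3).resolve_left Complex.I_ne_zero
  linear_combination (1 / 2) * h1 + (1 / 2) * h4

/-- Cutting off to `[-N, N]` yields test vectors lying in the domain of every power. -/
theorem exists_truncation (V : L2R ≃ₗᵢ[ℂ] H) {g : ℝ → ℂ} (hg : Continuous g) (φ : H) (N : ℕ) :
    ∃ χ : H, (V.symm χ : ℝ → ℂ) =ᵐ[volume]
        (Set.Icc (-N : ℝ) N).indicator (fun t => g t * V.symm φ t) ∧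
      ‖χ‖ₑ ^ 2 = ∫⁻ t in Set.Icc (-N : ℝ) N, ‖g t * V.symm φ t‖ₑ ^ 2 := by
  have hL := memLp_indicator_Icc_mul hg (Lp.memLp (V.symm φ)) N
  have h1 : (V.symm (V (hL.toLp _)) : ℝ → ℂ) =ᵐ[volume]
      (Set.Icc (-N : ℝ) N).indicator (fun t => g t * V.symm φ t) := by
    rw [V.symm_apply_apply]
    exact hL.coeFn_toLp
  refine ⟨V (hL.toLp _), h1, ?_⟩
  rw [enorm_sq_eq_lintegral V, ← lintegral_indicator measurableSet_Icc]
  refine lintegral_congr_ae ?_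
  filter_upwards [h1] with t ht
  rw [ht]
  by_cases hN : t ∈ Set.Icc (-N : ℝ) N
  · simp [hN]
  · simp [hN]

theorem memLp_pow_mul_truncation {V : L2R ≃ₗᵢ[ℂ] H} {g : ℝ → ℂ} (hg : Continuous g) {φ χ : H}
    {N : ℕ} (h : (V.symm χ : ℝ → ℂ) =ᵐ[volume]
      (Set.Icc (-N : ℝ) N).indicator (fun t => g t * V.symm φ t)) (c : ℝ) (k : ℕ) :
    MemLp (fun t : ℝ => ((c * t : ℝ) : ℂ) ^ k * V.symm χ t) 2 volume := by
  have hg' : Continuous fun t : ℝ => ((c * t : ℝ) : ℂ) ^ k * g t := by fun_prop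
  refine (memLp_indicator_Icc_mul hg' (Lp.memLp (V.symm φ)) N).ae_eq ?_
  filter_upwards [h] with t ht
  rw [ht]
  by_cases hN : t ∈ Set.Icc (-N : ℝ) N
  · simp only [Set.indicator_of_mem hN]
    ring
  · simp only [Set.indicator_of_notMem hN, mul_zero]

/-- A symmetric operator which has the same diagonal matrix elements as a multiplication operator
by a real function on the maximal domain of the latter is equal to it. -/
theorem eq_of_symmetric_of_diagonal (V : L2R ≃ₗᵢ[ℂ] H) {c : ℝ} {k : ℕ} {L M : H →ₗ.[ℂ] H}
    {m : ℝ → ℝ} (hm : Continuous m) {C : ℝ} (hC : ∀ t, |c * t| ^ k ≤ C + 2 * |m t|)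
    (hdom : ∀ φ, φ ∈ M.domain ↔ MemLp (fun t : ℝ => ((c * t : ℝ) : ℂ) ^ k * V.symm φ t) 2 volume)
    (hval : ∀ φ : M.domain, (V.symm (M φ) : ℝ → ℂ) =ᵐ[volume] fun t => (m t : ℂ) * V.symm (φ : H) t)
    (hle : M.domain ≤ L.domain)
    (hdiag : ∀ φ (h : φ ∈ M.domain), ⟪φ, L ⟨φ, hle h⟩⟫_ℂ = ⟪φ, M ⟨φ, h⟩⟫_ℂ)
    (hsymm : ∀ ψ φ : L.domain, ⟪(ψ : H), L φ⟫_ℂ = ⟪L ψ, (φ : H)⟫_ℂ) : L = M := by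
  have hmc : Continuous fun t => (m t : ℂ) := by fun_prop
  -- The truncations of `η` lie in `D(M)`, and pairing one with `η` gives its own squared norm.
  have hdense : ∀ η : H, (∀ ψ ∈ M.domain, ⟪ψ, η⟫_ℂ = 0) → η = 0 := by
    intro η hη
    have hz : ∫⁻ t, ‖(1 : ℂ) * V.symm η t‖ₑ ^ 2 ≤ 0 := by
      have := (Lp.stronglyMeasurable (V.symm η)).measurable
      refine lintegral_le_of_forall_Icc (by fun_prop) fun N => ?_
      obtain ⟨χ, h1, h2⟩ := exists_truncation V (continuous_const (y := (1 : ℂ))) η N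
      rw [← h2]
      have e : ⟪χ, χ⟫_ℂ = ⟪χ, η⟫_ℂ := by
        rw [← V.symm.inner_map_map, ← V.symm.inner_map_map, L2.inner_def, L2.inner_def]
        refine integral_congr_ae ?_
        filter_upwards [h1] with t ht
        rw [ht]
        by_cases hN : t ∈ Set.Icc (-N : ℝ) N
        · simp [hN]
        · simp [hN]
      rw [hη χ ((hdom χ).2 (memLp_pow_mul_truncation continuous_const h1 c k)),
        inner_self_eq_zero] at e
      simp [e]
    simp only [one_mul] at hz
    rw [← enorm_sq_eq_lintegral] at hz
    simpa using hz
  have hLM : ∀ φ (h : φ ∈ M.domain), L ⟨φ, hle h⟩ = M ⟨φ, h⟩ := by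
    intro φ h
    let X : M.domain →ₗ[ℂ] H := L.toFun ∘ₗ Submodule.inclusion hle - M.toFun
    have hX : ∀ φ : M.domain, ⟪(φ : H), X φ⟫_ℂ = 0 := fun φ => by
      change ⟪(φ : H), L ⟨φ, hle φ.2⟩ - M φ⟫_ℂ = 0
      rw [inner_sub_right, hdiag φ φ.2, sub_self]
    have := hdense (X ⟨φ, h⟩) fun ψ hψ => inner_eq_of_diagonal X hX ⟨ψ, hψ⟩ ⟨φ, h⟩
    exact sub_eq_zero.1 this
  -- Test with `χ`, the truncation of `m φ`: symmetry gives `‖χ‖² = ⟪M χ, φ⟫ = ⟪χ, L φ⟫`, so `‖χ‖ ≤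
  -- ‖L φ‖` uniformly in `N`. Hence `m φ` is square integrable, and `hC` passes this on to `(c t)ᵏ
  -- φ`.
  have hsub : L.domain ≤ M.domain := by
    intro φ hφ
    have hmeas := (Lp.stronglyMeasurable (V.symm φ)).measurable
    have hbound : ∫⁻ t, ‖(m t : ℂ) * V.symm φ t‖ₑ ^ 2 ≤ ‖L ⟨φ, hφ⟩‖ₑ ^ 2 := by
      refine lintegral_le_of_forall_Icc (by fun_prop) fun N => ?_
      obtain ⟨χ, h1, h2⟩ := exists_truncation V hmc φ N
      rw [← h2]
      have hχ := (hdom χ).2 (memLp_pow_mul_truncation hmc h1 c k)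
      have e : ⟪χ, χ⟫_ℂ = ⟪χ, L ⟨φ, hφ⟩⟫_ℂ := by
        rw [hsymm ⟨χ, hle hχ⟩ ⟨φ, hφ⟩, hLM χ hχ, ← V.symm.inner_map_map,
          ← V.symm.inner_map_map (M _), L2.inner_def, L2.inner_def]
        refine integral_congr_ae ?_
        filter_upwards [h1, hval ⟨χ, hχ⟩] with t ht ht'
        rw [ht', ht]
        by_cases hN : t ∈ Set.Icc (-N : ℝ) N
        · simp only [Set.indicator_of_mem hN, RCLike.inner_apply, map_mul]
          rw [← RCLike.star_def, Complex.star_def, Complex.conj_ofReal]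
          ring
        · simp [hN]
      have h3 := norm_inner_le_norm (𝕜 := ℂ) χ (L ⟨φ, hφ⟩)
      rw [← e, inner_self_eq_norm_sq_to_K] at h3
      have h4 : ‖χ‖ ≤ ‖L ⟨φ, hφ⟩‖ := by
        have h5 : ‖χ‖ ^ 2 ≤ ‖χ‖ * ‖L ⟨φ, hφ⟩‖ := by simpa using h3
        rcases (norm_nonneg χ).eq_or_lt with h0 | h0
        · rw [← h0]
          exact norm_nonneg _
        · rw [sq] at h5
          exact le_of_mul_le_mul_left h5 h0
      rw [← ofReal_norm, ← ofReal_norm]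
      gcongr
    have hmφ : MemLp (fun t => (m t : ℂ) * V.symm φ t) 2 volume := by
      refine ⟨(by fun_prop : Measurable _).aestronglyMeasurable, ?_⟩
      have := eLpNorm_nnreal_pow_eq_lintegral (f := fun t => (m t : ℂ) * V.symm φ t)
        (μ := (volume : Measure ℝ)) (p := 2) two_ne_zero
      simp only [ENNReal.coe_ofNat, NNReal.coe_ofNat, ENNReal.rpow_ofNat] at this
      rw [← ENNReal.pow_lt_top_iff.trans (or_iff_left two_ne_zero), this]
      exact hbound.trans_lt (by finiteness)
    rw [hdom]
    refine (((Lp.memLp (V.symm φ)).norm.const_mul C).add (hmφ.norm.const_mul 2)).of_le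
      (by fun_prop : Measurable _).aestronglyMeasurable (Eventually.of_forall fun t => ?_)
    rw [Pi.add_apply, norm_mul _ (V.symm φ t), norm_mul (m t : ℂ), norm_pow, Complex.norm_real,
      Complex.norm_real]
    refine le_trans ?_ (le_abs_self _)
    have := mul_le_mul_of_nonneg_right (hC t) (norm_nonneg (V.symm φ t))
    simp only [Real.norm_eq_abs]
    linarith
  exact LinearPMap.ext (le_antisymm hsub hle) fun φ h1 h2 => hLM φ h2

end SelfAdjoint

/-- For `|x| ≥ r` the lower-order terms are at most half of `|x|ᵏ`; for `|x| ≤ r` the constant `rᵏ`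
suffices. Thus a monic polynomial has the same maximal multiplication domain as its leading term. -/
theorem exists_pow_le_monic (k : ℕ) (a : ℕ → ℝ) :
    ∃ C : ℝ, ∀ x : ℝ, |x| ^ k ≤ C + 2 * |x ^ k + ∑ l ∈ Finset.range k, a l * x ^ l| := by
  set r : ℝ := 1 + 2 * ∑ l ∈ Finset.range k, |a l| with hr
  have hs : 0 ≤ ∑ l ∈ Finset.range k, |a l| := Finset.sum_nonneg fun _ _ => abs_nonneg _
  refine ⟨r ^ k, fun x => ?_⟩
  rcases le_total |x| r with h | h
  · have := pow_le_pow_left₀ (abs_nonneg x) h k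
    have := abs_nonneg (x ^ k + ∑ l ∈ Finset.range k, a l * x ^ l)
    linarith
  · have hx1 : 1 ≤ |x| := by linarith
    have h0 : 0 ≤ r ^ k := by positivity
    have hsum : |∑ l ∈ Finset.range k, a l * x ^ l| * 2 ≤ |x| ^ k := by
      rcases Nat.eq_zero_or_pos k with rfl | hk
      · simp
      obtain ⟨j, rfl⟩ := Nat.exists_eq_succ_of_ne_zero hk.ne'
      have h1 : |∑ l ∈ Finset.range (j + 1), a l * x ^ l| ≤
          (∑ l ∈ Finset.range (j + 1), |a l|) * |x| ^ j := by
        rw [Finset.sum_mul]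
        refine (Finset.abs_sum_le_sum_abs _ _).trans (Finset.sum_le_sum fun l hl => ?_)
        rw [abs_mul, abs_pow]
        exact mul_le_mul_of_nonneg_left
          (pow_le_pow_right₀ hx1 (Nat.lt_succ_iff.1 (Finset.mem_range.1 hl))) (abs_nonneg _)
      have h2 : 0 ≤ |x| ^ j := by positivity
      rw [pow_succ]
      have h3 : 2 * ∑ l ∈ Finset.range (j + 1), |a l| ≤ |x| := by linarith
      nlinarith
    have h4 := abs_sub_abs_le_abs_sub (x ^ k) (-∑ l ∈ Finset.range k, a l * x ^ l)
    rw [sub_neg_eq_add, abs_neg, abs_pow] at h4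
    linarith

/-! ### The operator integral equals the moment polynomial. -/

section Main

variable {H : Type*} [NormedAddCommGroup H] [InnerProductSpace ℂ H] [CompleteSpace H]
variable {U V : L2R ≃ₗᵢ[ℂ] H} {c : ℝ} {R : ℝ × ℝ → ℝ × ℝ} {k : ℕ} {S B : H →L[ℂ] H}

/-- The squared norm is a multiple of the `2k`-th absolute moment of `c(t - s)`. It is finite
because `t` has such a moment when `φ ∈ D(Aᵏ)` and `s` has one when `Aᵏ S` is Hilbert–Schmidt. -/
theorem memLp_pow_mul_norm_translated (hW : Intertwines U V c R) (hc : 0 < c)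
    (hR : MeasurePreserving R volume volume)
    (h : prodOp (powOp (scaledPosition V c) k) (ofBounded S) = ofBounded B)
    (hS : Summable fun n => ‖S (onb H n)‖ ^ 2) (hB : Summable fun n => ‖B (onb H n)‖ ^ 2)
    (hSS : ContinuousLinearMap.adjoint S = S) {φ : H}
    (hφ : φ ∈ (powOp (scaledPosition V c) k).domain) :
    MemLp (fun z => |(R z).1| ^ k * ‖translated U S φ z‖) 2 volume := by
  have hmR : Measurable fun z => (R z).1 := measurable_fst.comp hR.measurable
  have hmN := measurable_norm_translated U S φ
  refine ⟨(by fun_prop : Measurable _).aestronglyMeasurable, ?_⟩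
  have hfin := isFiniteMeasure_rangeMeasure V hS
  have key := eLpNorm_nnreal_pow_eq_lintegral
    (f := fun z => |(R z).1| ^ k * ‖translated U S φ z‖)
    (μ := (volume : Measure (ℝ × ℝ))) (p := 2) two_ne_zero
  have habs : ∀ x : ℝ, ‖|x|‖ₑ = ‖x‖ₑ := fun x => by
    rw [← ofReal_norm, ← ofReal_norm, Real.norm_eq_abs, Real.norm_eq_abs, abs_abs]
  simp only [ENNReal.coe_ofNat, NNReal.coe_ofNat, ENNReal.rpow_ofNat, enorm_mul, enorm_pow,
    habs, enorm_norm, mul_pow] at key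
  rw [lintegral_mul_enorm_sq_translated (u := fun x => (‖x‖ₑ ^ k) ^ 2) hW hc hR S φ
    (by fun_prop), hSS] at key
  rw [← ENNReal.pow_lt_top_iff.trans (or_iff_left two_ne_zero), key]
  refine ENNReal.mul_lt_top ENNReal.ofReal_lt_top (lintegral_lintegral_pow_lt_top ?_ ?_)
  · rw [lintegral_pow_densityMeasure V hc.ne' ⟨φ, hφ⟩]
    finiteness
  · rw [lintegral_pow_rangeMeasure V hc.ne' h]
    exact (summable_norm_sq_iff _).1 hB

/-- Cauchy–Schwarz with the whole weight on the `φ` factor, so that `ψ` can be arbitrary. -/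
theorem integrable_pow_mul_inner_translated (hW : Intertwines U V c R) (hc : 0 < c)
    (hR : MeasurePreserving R volume volume)
    (h : prodOp (powOp (scaledPosition V c) k) (ofBounded S) = ofBounded B)
    (hS : Summable fun n => ‖S (onb H n)‖ ^ 2) (hB : Summable fun n => ‖B (onb H n)‖ ^ 2)
    (hSS : ContinuousLinearMap.adjoint S = S) {φ : H}
    (hφ : φ ∈ (powOp (scaledPosition V c) k).domain) (ψ : H) :
    Integrable fun z => ((R z).1 : ℂ) ^ k * ⟪translated U S ψ z, translated U S φ z⟫_ℂ := by
  have hmR : Measurable fun z => (R z).1 := measurable_fst.comp hR.measurable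
  have hmi := measurable_inner_translated U S ψ φ
  refine ((memLp_norm_translated U hS ψ).integrable_mul
    (memLp_pow_mul_norm_translated hW hc hR h hS hB hSS hφ)).mono'
    (by fun_prop : Measurable _).aestronglyMeasurable (Eventually.of_forall fun z => ?_)
  rw [Pi.mul_apply, norm_mul, norm_pow, Complex.norm_real, Real.norm_eq_abs]
  have := mul_le_mul_of_nonneg_left (norm_inner_le_norm (𝕜 := ℂ) (translated U S ψ z)
    (translated U S φ z)) (pow_nonneg (abs_nonneg (R z).1) k)
  linarith

theorem map_withDensity_translated (hW : Intertwines U V c R) (hc : 0 < c)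
    (hR : MeasurePreserving R volume volume) (hS : Summable fun n => ‖S (onb H n)‖ ^ 2)
    (hSS : ContinuousLinearMap.adjoint S = S) (φ : H) :
    (volume.withDensity fun z => ‖translated U S φ z‖ₑ ^ 2).map (fun z => (R z).1) =
      ENNReal.ofReal (2 * Real.pi) • ((densityMeasure (V.symm φ)).prod (rangeMeasure V S)).map
        (fun p : ℝ × ℝ => c * (p.1 - p.2)) := by
  have hfin := isFiniteMeasure_rangeMeasure V hS
  have hmR : Measurable fun z => (R z).1 := measurable_fst.comp hR.measurable
  have hmN := measurable_enorm_translated U S φ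
  refine Measure.ext_of_lintegral _ fun u hu => ?_
  have huR : Measurable fun z => u (R z).1 := hu.comp hmR
  rw [lintegral_smul_measure, lintegral_map hu hmR, lintegral_map hu (by fun_prop),
    lintegral_withDensity_eq_lintegral_mul _ (by fun_prop) huR,
    lintegral_prod _ (by fun_prop)]
  have := lintegral_mul_enorm_sq_translated hW hc hR S φ hu
  rw [hSS] at this
  rw [smul_eq_mul, ← this]
  refine lintegral_congr fun z => ?_
  rw [Pi.mul_apply, mul_comm]

theorem integral_pow_withDensity_translated (hW : Intertwines U V c R) (hc : 0 < c)
    (hR : MeasurePreserving R volume volume)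
    (h : prodOp (powOp (scaledPosition V c) k) (ofBounded S) = ofBounded B)
    (hS : Summable fun n => ‖S (onb H n)‖ ^ 2) (hB : Summable fun n => ‖B (onb H n)‖ ^ 2)
    (hSS : ContinuousLinearMap.adjoint S = S) {φ : H}
    (hφ : φ ∈ (powOp (scaledPosition V c) k).domain) :
    ∫ z, ((R z).1 : ℂ) ^ k ∂(volume.withDensity fun z => ‖translated U S φ z‖ₑ ^ 2) =
      2 * Real.pi * ∑ l ∈ Finset.range (k + 1), (k.choose l : ℂ) * (-1) ^ (k - l) *
        trace (prodOp (powOp (scaledPosition V c) (k - l)) (ofBounded (S ∘L S))) *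
          ∫ t, ((c * t : ℝ) : ℂ) ^ l ∂(densityMeasure (V.symm φ)) := by
  have hfin := isFiniteMeasure_rangeMeasure V hS
  have hmR : Measurable fun z => (R z).1 := measurable_fst.comp hR.measurable
  have hpow : ∀ μ : Measure ℝ, AEStronglyMeasurable (fun x : ℝ => (x : ℂ) ^ k) μ := fun μ =>
    (by fun_prop : Continuous fun x : ℝ => (x : ℂ) ^ k).aestronglyMeasurable
  have h1 := integral_map (μ := volume.withDensity fun z => ‖translated U S φ z‖ₑ ^ 2)
    (φ := fun z => (R z).1) hmR.aemeasurable (f := fun x : ℝ => (x : ℂ) ^ k) (hpow _)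
  rw [← h1, map_withDensity_translated hW hc hR hS hSS, integral_smul_measure,
    integral_map (by fun_prop) (hpow _), integral_prod_sub_pow (k := k)]
  · rw [ENNReal.toReal_ofReal (by positivity), Complex.real_smul]
    push_cast
    congr 1
    refine Finset.sum_congr rfl fun l _ => ?_
    have := integral_pow_rangeMeasure hc.ne' h hS hB hSS (Nat.sub_le k l)
    push_cast at this
    rw [this]
  · rw [lintegral_pow_densityMeasure V hc.ne' ⟨φ, hφ⟩]
    finiteness
  · rw [lintegral_pow_rangeMeasure V hc.ne' h]
    exact (summable_norm_sq_iff _).1 hB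

/-- Reality of the moments makes the polynomial real, as the maximality argument requires. -/
theorem trace_powOp_prod_real (hc : c ≠ 0)
    (h : prodOp (powOp (scaledPosition V c) k) (ofBounded S) = ofBounded B)
    (hS : Summable fun n => ‖S (onb H n)‖ ^ 2) (hB : Summable fun n => ‖B (onb H n)‖ ^ 2)
    (hSS : ContinuousLinearMap.adjoint S = S) {j : ℕ} (hjk : j ≤ k) :
    trace (prodOp (powOp (scaledPosition V c) j) (ofBounded (S ∘L S))) =
      ((∫ s, (c * s) ^ j ∂(rangeMeasure V S) : ℝ) : ℂ) := by
  rw [← integral_pow_rangeMeasure hc h hS hB hSS hjk, ← integral_complex_ofReal]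
  push_cast
  rfl

theorem operatorIntegral_eq_momentPolynomial (hW : Intertwines U V c R) (hc : 0 < c)
    (hR : MeasurePreserving R volume volume)
    (h : prodOp (powOp (scaledPosition V c) k) (ofBounded S) = ofBounded B)
    (hS : Summable fun n => ‖S (onb H n)‖ ^ 2) (hB : Summable fun n => ‖B (onb H n)‖ ^ 2)
    (hSS : ContinuousLinearMap.adjoint S = S) (hone : trace (ofBounded (S ∘L S)) = 1)
    {f : ℝ × ℝ → ℂ} (hf : Measurable f) (hfR : ∀ z, f z = ((R z).1 : ℂ) ^ k) :
    (covariantObservable U (S ∘L S)).operatorIntegral hf =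
      momentPolynomial (scaledPosition V c) (S ∘L S) k := by
  have hT : S ∘L S = ContinuousLinearMap.adjoint S ∘L S := by rw [hSS]
  have hE := isGeneratedBy_covariantObservable U hT hS
  set E := covariantObservable U (S ∘L S)
  obtain rfl : f = fun z => ((R z).1 : ℂ) ^ k := funext hfR
  set τ : ℕ → ℝ := fun j => ∫ s, (c * s) ^ j ∂(rangeMeasure V S) with hτ
  have hτ' : ∀ j ≤ k, trace (prodOp (powOp (scaledPosition V c) j) (ofBounded (S ∘L S))) =
      (τ j : ℂ) := fun j hj => trace_powOp_prod_real hc.ne' h hS hB hSS hj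
  -- The normalization `Tr T = 1` makes the polynomial monic.
  have hτ0 : τ 0 = 1 := by
    have h0 := hτ' 0 (Nat.zero_le k)
    have e : prodOp (powOp (scaledPosition V c) 0) (ofBounded (S ∘L S)) = ofBounded (S ∘L S) :=
      LinearPMap.ext (by ext x; exact ⟨fun _ => trivial, fun _ => ⟨trivial, trivial⟩⟩)
        fun x _ _ => rfl
    rw [e, hone] at h0
    exact_mod_cast h0.symm
  set a : ℕ → ℝ := fun l => (k.choose l : ℝ) * (-1) ^ (k - l) * τ (k - l) with ha
  obtain ⟨C, hC⟩ := exists_pow_le_monic k a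
  have hint := fun {φ : H} hφ ψ =>
    integrable_pow_mul_inner_translated (φ := φ) hW hc hR h hS hB hSS hφ ψ
  have hdomM := fun φ => mem_momentPolynomial V hc.ne' (S ∘L S) k φ
  refine eq_of_symmetric_of_diagonal V (c := c) (k := k)
    (m := fun t => ∑ l ∈ Finset.range (k + 1), a l * (c * t) ^ l) (by fun_prop) (C := C) ?_
    (fun φ => (hdomM φ).trans (mem_powOp_scaledPosition V hc.ne')) ?_ ?_ ?_ ?_
  · intro t
    have := hC (c * t)
    rw [Finset.sum_range_succ]
    have hak : a k = 1 := by simp [ha, hτ0]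
    rw [hak, one_mul, add_comm (∑ l ∈ Finset.range k, a l * (c * t) ^ l)]
    exact this
  · intro φ
    filter_upwards [coeFn_momentPolynomial V hc.ne' (S ∘L S) k φ] with t ht
    rw [ht]
    congr 1
    push_cast
    refine Finset.sum_congr rfl fun l _ => ?_
    rw [hτ' _ (Nat.sub_le k l), ha]
    push_cast
    rfl
  · intro φ hφ ψ
    exact integrable_scalar hE hT hf (hint ((hdomM φ).1 hφ) ψ)
  · intro φ hφ
    have hφk := (hdomM φ).1 hφ
    rw [PositiveOperatorMeasure.inner_operatorIntegral,
      integral_scalar_self hE hT hS hf (hint hφk φ),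
      integral_pow_withDensity_translated hW hc hR h hS hB hSS hφk, ← mul_assoc,
      inv_mul_cancel₀ (by simp [Real.pi_ne_zero]), one_mul]
    classical
    have hl : ∀ l ∈ Finset.range (k + 1), φ ∈ (powOp (scaledPosition V c) l).domain :=
      (mem_domain_sum_smul _ _ (fun l => powOp (scaledPosition V c) l) _).1 hφ
    set v : ℕ → H := fun l => if h : φ ∈ (powOp (scaledPosition V c) l).domain then
      powOp (scaledPosition V c) l ⟨φ, h⟩ else 0 with hv
    have e := sum_smul_apply (Finset.range (k + 1)) (fun l => (k.choose l : ℂ) * (-1) ^ (k - l) *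
      trace (prodOp (powOp (scaledPosition V c) (k - l)) (ofBounded (S ∘L S))))
      (fun l => powOp (scaledPosition V c) l) φ v (fun l _ h => by simp [hv, h]) hφ
    refine Eq.trans ?_ (congrArg (fun x => ⟪φ, x⟫_ℂ) e).symm
    simp only [inner_sum, inner_smul_right]
    refine Finset.sum_congr rfl fun l hl' => ?_
    rw [integral_pow_densityMeasure V hc.ne' ⟨φ, hl l hl'⟩]
    simp only [hv, hl l hl', dite_true]
  · refine inner_operatorIntegral_symm hf fun z => ?_
    rw [map_pow, Complex.conj_ofReal]

theorem moments_of_intertwines (hW : Intertwines U V c R) (hc : 0 < c)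
    (hR : MeasurePreserving R volume volume) {T : H →L[ℂ] H} (hT : T.IsPositive)
    (hT_class : IsTraceClass (ofBounded T)) (hT_one : trace (ofBounded T) = 1)
    {f : ℝ × ℝ → ℂ} (hf : Measurable f) (hfR : ∀ z, f z = ((R z).1 : ℂ) ^ k)
    (hHS : IsHilbertSchmidt
      (prodOp (powOp (scaledPosition V c) k) (ofBounded (CFC.sqrt T)))) :
    (∀ l ≤ k, IsTraceClass (prodOp (powOp (scaledPosition V c) (k - l)) (ofBounded T))) ∧
      (covariantObservable U T).operatorIntegral hf =
        momentPolynomial (scaledPosition V c) T k := by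
  have hT0 : 0 ≤ T := (ContinuousLinearMap.nonneg_iff_isPositive T).2 hT
  have hSpos : (CFC.sqrt T).IsPositive :=
    (ContinuousLinearMap.nonneg_iff_isPositive _).1 (CFC.sqrt_nonneg T)
  have hSS : ContinuousLinearMap.adjoint (CFC.sqrt T) = CFC.sqrt T := hSpos.isSelfAdjoint
  have hTS : T = CFC.sqrt T ∘L CFC.sqrt T := (CFC.sqrt_mul_sqrt_self T hT0).symm
  -- As `T ≥ 0`, `|T| = T` and `⟪e, T e⟫ = ‖√T e‖²`.
  have hS : Summable fun n => ‖CFC.sqrt T (onb H n)‖ ^ 2 := by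
    obtain ⟨T', hT', hsum⟩ := hT_class
    have e : T = T' := by
      ext x
      exact (LinearPMap.ext_iff.1 hT').2 (x := x) (hf := trivial) (hg := trivial)
    subst e
    rw [CFC.abs_of_nonneg T hT0] at hsum
    refine hsum.congr fun n => ?_
    have e : ⟪(onb H n : H), T (onb H n)⟫_ℂ =
        ⟪CFC.sqrt T (onb H n), CFC.sqrt T (onb H n)⟫_ℂ := by
      conv_lhs => rw [hTS]
      rw [ContinuousLinearMap.comp_apply, ← ContinuousLinearMap.adjoint_inner_left, hSS]
    rw [e]
    exact (norm_sq_eq_re_inner (𝕜 := ℂ) _).symm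
  obtain ⟨B, h, hB⟩ := hHS
  generalize CFC.sqrt T = S at *
  subst hTS
  exact ⟨fun l _ => isTraceClass_powOp_prod hc.ne' h hS hB (Nat.sub_le k l),
    operatorIntegral_eq_momentPolynomial hW hc hR h hS hB hSS hT_one hf hfR⟩

end Main

/-! ### Specialization to position and momentum. -/

theorem opQ_eq_scaledPosition {H : Type*} [NormedAddCommGroup H] [InnerProductSpace ℂ H]
    [CompleteSpace H] (U : L2R ≃ₗᵢ[ℂ] H) : opQ U = scaledPosition U 1 := by
  rw [opQ, scaledPosition, Complex.ofReal_one, one_smul]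

theorem opP_eq_scaledPosition {H : Type*} [NormedAddCommGroup H] [InnerProductSpace ℂ H]
    [CompleteSpace H] (U : L2R ≃ₗᵢ[ℂ] H) :
    opP U = scaledPosition ((Lp.fourierTransformₗᵢ ℝ ℂ).symm.trans U) (2 * Real.pi) := by
  have : ((2 * Real.pi : ℝ) : ℂ) = 2 * (Real.pi : ℂ) := by push_cast; rfl
  rw [scaledPosition, this]
  rfl

/-- Conjugation by the Fourier transform rotates phase space by a quarter turn; the scale `2π`
reflects the kernel `exp(-2πi t ξ)`. -/
theorem intertwines_fourierTransform {H : Type*} [NormedAddCommGroup H] [InnerProductSpace ℂ H]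
    (U : L2R ≃ₗᵢ[ℂ] H) :
    Intertwines U ((Lp.fourierTransformₗᵢ ℝ ℂ).symm.trans U) (2 * Real.pi)
      fun z => (z.2, -z.1) := fun z h => by
  have e := fourierTransform_weyl₀ z.1 z.2 ((Lp.fourierTransformₗᵢ ℝ ℂ).symm h)
  rw [LinearIsometryEquiv.apply_symm_apply] at e
  change U (weyl₀ (-z.1) z.2 (U.symm (U ((Lp.fourierTransformₗᵢ ℝ ℂ).symm h)))) =
    U ((Lp.fourierTransformₗᵢ ℝ ℂ).symm (weyl₀ (-z.2 / (2 * Real.pi)) (2 * Real.pi * -z.1) h))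
  rw [mul_neg, ← e, LinearIsometryEquiv.symm_apply_apply, LinearIsometryEquiv.symm_apply_apply]

theorem measurePreserving_rotate :
    MeasurePreserving (fun z : ℝ × ℝ => (z.2, -z.1)) volume volume :=
  ((MeasurePreserving.id (volume : Measure ℝ)).prod
    (Measure.measurePreserving_neg (volume : Measure ℝ))).comp Measure.measurePreserving_swap

theorem mainTheorem1 {H : Type*} [NormedAddCommGroup H] [InnerProductSpace ℂ H] [CompleteSpace H]
    (U : L2R ≃ₗᵢ[ℂ] H) (T : H →L[ℂ] H) (hT : T.IsPositive)
    (hT_class : IsTraceClass (ofBounded T)) (hT_one : trace (ofBounded T) = 1) (k : ℕ) :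
    (IsHilbertSchmidt (prodOp (powOp (opQ U) k) (ofBounded (CFC.sqrt T))) →
      (∀ l ≤ k, IsTraceClass (prodOp (powOp (opQ U) (k - l)) (ofBounded T))) ∧
      (covariantObservable U T).operatorIntegral (measurable_xPow k) =
        momentPolynomial (opQ U) T k) ∧
    (IsHilbertSchmidt (prodOp (powOp (opP U) k) (ofBounded (CFC.sqrt T))) →
      (∀ l ≤ k, IsTraceClass (prodOp (powOp (opP U) (k - l)) (ofBounded T))) ∧
      (covariantObservable U T).operatorIntegral (measurable_yPow k) =
        momentPolynomial (opP U) T k) := by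
  refine ⟨fun h => ?_, fun h => ?_⟩
  · rw [opQ_eq_scaledPosition] at h ⊢
    exact moments_of_intertwines (intertwines_id U) one_pos (MeasurePreserving.id _) hT hT_class
      hT_one (measurable_xPow k) (fun z => rfl) h
  · rw [opP_eq_scaledPosition] at h ⊢
    exact moments_of_intertwines (intertwines_fourierTransform U) (by positivity)
      measurePreserving_rotate hT hT_class hT_one (measurable_yPow k) (fun z => rfl) h
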